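/- Let $(M,g)$ be a smooth finite-dimensional Riemannian manifold (Hausdorff, without boundary) with Levi-Civita connection $\nabla$ and curvature $\mathfrak R(X,Y)Z=\nabla_X\nabla_YZ-\nabla_Y\nabla_XZ-\nabla_{[X,Y]}Z$. Let $\pi:TM\to M$ be the projection and $K:T_{(p,u)}TM\to T_pM$ the connection map of $\nabla$; for $a\in T_pM$ let $a^h$ be the vector of $T_{(p,u)}TM$ with $d\pi(a^h)=a$, $K(a^h)=0$, and $a^v$ the one with $d\pi(a^v)=0$, $K(a^v)=a$. A curve in $TM$ is horizontal if $K$ vanishes on its velocity; a vector field on $TM$ is horizontal (vertical) if its values lie in $\ker K$ (in $\ker d\pi$). Let $m_1,m_2,m_3\in\mathbb R$ with $m_1,m_3>0$ and $\Delta=m_1m_3-m_2^2>0$, and let $\bar\nabla$ be the Levi-Civita connection of the Riemannian metric $\bar g$ on $TM$ given by $$\bar g(X^h,Y^h)=m_1\,g(X,Y),\qquad \bar g(X^h,Y^v)=m_2\,g(X,Y),\qquad \bar g(X^v,Y^v)=m_3\,g(X,Y).$$ Let $\bar X,\bar Y$ be smooth vector fields on $TM$ (not assumed constant along the fibers) and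 let $(p,u)\in TM$. 1. Near $(p,u)$ one can write $\bar Y=A^h+B^v+\bar C+\bar D$, where $A,B$ are vector fields on $M$, smooth near $p$, $\bar C$ is a horizontal and $\bar D$ a vertical vector field on $TM$, $\bar C=\bar D=0$ at $(p,u)$, and $\bar C$ and $\bar D$ vanish along horizontal curves through $(p,u)$, in every horizontal direction: for every $a\in T_pM$ there is a smooth horizontal curve through $(p,u)$ with velocity $a^h$ there, along which $\bar C=\bar D=0$. 2. For every such decomposition, with $\bar X_{(p,u)}=F^h+G^v$, $F,G\in T_pM$, and for every chart of $M$ at $p$, at the point $(p,u)$ $$\bar\nabla_{\bar X}\bar Y=\bar\nabla_{F^h+G^v}(A^h+B^v)+\tilde\nabla_{G^v}(\bar C+\bar D),$$ where $\tilde\nabla$ is the flat connection of the coordinates on $TM$ induced by the chart (so that $\tilde\nabla_{G^v}$ differentiates components in the fiber coordinates in the direction $G$), and the first term is given by $$d\pi\big(\bar\nabla_{F^h+G^v}(A^h+B^v)\big)=\nabla_FA+\frac1\Delta\Big(m_2m_3\,\mathfrak R(u,F)A+\frac{m_2m_3}{2}\mathfrak R(F,A)u+\frac{m_3^2}{2}\mathfrak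 R(u,B)F+\frac{m_3^2}{2}\mathfrak R(u,G)A\Big),$$ $$K\big(\bar\nabla_{F^h+G^v}(A^h+B^v)\big)=\nabla_FB+\frac1\Delta\Big(-m_2^2\,\mathfrak R(u,F)A-\frac{m_1m_3}{2}\mathfrak R(F,A)u-\frac{m_2m_3}{2}\mathfrak R(u,B)F-\frac{m_2m_3}{2}\mathfrak R(u,G)A\Big).$$ -/

import Mathlib

open Bundle Set Filter
open scoped Manifold ContDiff Topology

noncomputable section

namespace TangentLift

variable {E : Type*} [NormedAddCommGroup E] [NormedSpace ℝ E]
  {H : Type*} [TopologicalSpace H] {I : ModelWithCorners ℝ E H}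
  {M : Type*} [TopologicalSpace M] [ChartedSpace H M]

/-- The covariant derivative `cov` on the tangent bundle of `M` is the Levi-Civita connection of the
field `g` of bilinear forms: it is torsion-free and compatible with `g`.
(`cov Y x v` is the derivative of the vector field `Y` at `x` in the direction `v`.) -/
structure IsLeviCivita [IsManifold I 1 M]
    (g : ∀ x : M, TangentSpace I x → TangentSpace I x → ℝ)
    (cov : CovariantDerivative I E (TangentSpace I : M → Type _)) : Prop where
  torsion_free : ∀ {X Y : ∀ x : M, TangentSpace I x} {x : M},
    MDiffAt (T% X) x → MDiffAt (T% Y) x →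
      cov Y x (X x) - cov X x (Y x) = VectorField.mlieBracket I X Y x
  compatible : ∀ {Y Z : ∀ x : M, TangentSpace I x} {x : M},
    MDiffAt (T% Y) x → MDiffAt (T% Z) x → ∀ v : TangentSpace I x,
      mfderiv I 𝓘(ℝ, ℝ) (fun y => g y (Y y) (Z y)) x v
        = g x (cov Y x v) (Z x) + g x (Y x) (cov Z x v)

/-- `R(X, Y) Z = ∇_X ∇_Y Z - ∇_Y ∇_X Z - ∇_[X, Y] Z` for vector fields. -/
def curvatureField [IsManifold I 1 M]
    (cov : CovariantDerivative I E (TangentSpace I : M → Type _))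
    (X Y Z : ∀ x : M, TangentSpace I x) (x : M) : TangentSpace I x :=
  cov (fun y => cov Z y (Y y)) x (X x) - cov (fun y => cov Z y (X y)) x (Y x)
    - cov Z x (VectorField.mlieBracket I X Y x)

/-- The curvature tensor `R(a, b) c` at a point: the tangent vectors are extended to vector fields
that are smooth near the point. -/
def curvature [IsManifold I 1 M]
    (cov : CovariantDerivative I E (TangentSpace I : M → Type _))
    (x : M) (a b c : TangentSpace I x) : TangentSpace I x :=
  curvatureField cov (FiberBundle.extend E a) (FiberBundle.extend E b) (FiberBundle.extend E c) x

variable [IsManifold I 1 M]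

/-- The differential `dπ` of the projection `π : TM → M` at `P = (p, u)`. -/
def dproj (P : TangentBundle I M) : TangentSpace I.tangent P →L[ℝ] TangentSpace I P.proj :=
  mfderiv I.tangent I (fun Q : TangentBundle I M => Q.proj) P

/-- The connection map `K : T_{(p,u)} TM → T_p M` of the connection `cov`. In the coordinates of the
trivialization of `TM` at `p`, the first term is the fiber component of `ξ`, and the
second one is `Γ(dπ ξ, u)`, as `FiberBundle.extend E u` is the extension of `u` which is constant in
these coordinates. It is the map with `K (dY v) = ∇_v Y` for all vector fields `Y` and
with `K (b^v) = b`. -/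
def connectionMap (cov : CovariantDerivative I E (TangentSpace I : M → Type _))
    (P : TangentBundle I M) (ξ : TangentSpace I.tangent P) : TangentSpace I P.proj :=
  (trivializationAt E (TangentSpace I : M → Type _) P.proj).symm P.proj
      (mfderiv I.tangent 𝓘(ℝ, E)
        (fun Q : TangentBundle I M =>
          (trivializationAt E (TangentSpace I : M → Type _) P.proj Q).2) P ξ)
    + cov (FiberBundle.extend E P.snd) P.proj (dproj P ξ)

/-- The vertical lift of `b ∈ T_p M` at `P = (p, u)`: the velocity at `s = 0` of the curve
`s ↦ (p, u + s b)`. -/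
def vlift (P : TangentBundle I M) (b : TangentSpace I P.proj) : TangentSpace I.tangent P :=
  mfderiv 𝓘(ℝ, E) I.tangent (fun w : E => (⟨P.proj, w⟩ : TangentBundle I M)) P.snd b

/-- The horizontal lift of `a ∈ T_p M` at `P = (p, u)`, the unique tangent vector of `TM` with
`dπ = a` and `K = 0` (see `dproj_hlift`, `connectionMap_hlift` and `eq_of_dproj_of_connectionMap`).
In the preferred coordinates of `TM` at `P` it is `(a, -Γ(a, u))`. -/
def hlift (cov : CovariantDerivative I E (TangentSpace I : M → Type _))
    (P : TangentBundle I M) (a : TangentSpace I P.proj) : TangentSpace I.tangent P :=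
  show E × E from ((show E from a), -(show E from cov (FiberBundle.extend E P.snd) P.proj a))

lemma hasMFDerivAt_proj (P : TangentBundle I M) :
    HasMFDerivAt I.tangent I (fun Q : TangentBundle I M => Q.proj) P
      (ContinuousLinearMap.fst ℝ E E) := by
  have hs : MDiffAt (fun Q : TangentBundle I M => Q.proj) P :=
    (Bundle.contMDiff_proj (TangentSpace I : M → Type _) (n := 1) (IB := I)
      (F := E)).mdifferentiableAt (by simp)
  refine ⟨hs.continuousAt, ?_⟩
  have h1 : HasFDerivWithinAt (Prod.fst : E × E → E) (ContinuousLinearMap.fst ℝ E E)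
    (range I.tangent) (extChartAt I.tangent P P) := hasFDerivWithinAt_fst
  refine h1.congr_of_eventuallyEq ?_ ?_
  · filter_upwards [extChartAt_target_mem_nhdsWithin (I := I.tangent) P] with x hx
    conv_rhs => rw [← (extChartAt I.tangent P).right_inv hx]
    rfl
  · simp only [writtenInExtChartAt, Function.comp_apply, extChartAt_to_inv]
    rfl

lemma hasMFDerivAt_fiberCoord (P : TangentBundle I M) :
    HasMFDerivAt I.tangent 𝓘(ℝ, E) (fun Q : TangentBundle I M =>
          (trivializationAt E (TangentSpace I : M → Type _) P.proj Q).2) P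
      (ContinuousLinearMap.snd ℝ E E) := by
  have hs : MDiffAt (fun Q : TangentBundle I M =>
          (trivializationAt E (TangentSpace I : M → Type _) P.proj Q).2) P := by
    have := (Bundle.contMDiffAt_totalSpace (n := 1) (IM := I.tangent) (IB := I)
      (f := fun Q : TangentBundle I M => Q) (x₀ := P)).1 contMDiffAt_id
    exact this.2.mdifferentiableAt (by simp)
  refine ⟨hs.continuousAt, ?_⟩
  have h1 : HasFDerivWithinAt (Prod.snd : E × E → E) (ContinuousLinearMap.snd ℝ E E)
    (range I.tangent) (extChartAt I.tangent P P) := hasFDerivWithinAt_snd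
  refine h1.congr_of_eventuallyEq ?_ ?_
  · filter_upwards [extChartAt_target_mem_nhdsWithin (I := I.tangent) P] with x hx
    conv_rhs => rw [← (extChartAt I.tangent P).right_inv hx]
    rfl
  · simp only [writtenInExtChartAt, Function.comp_apply, extChartAt_to_inv]
    rfl

lemma hasMFDerivAt_fiberIncl (P : TangentBundle I M) :
    HasMFDerivAt 𝓘(ℝ, E) I.tangent (fun w : E => (⟨P.proj, w⟩ : TangentBundle I M)) P.snd
      (ContinuousLinearMap.inr ℝ E E) := by
  have key : ∀ w : E, extChartAt I.tangent P (⟨P.proj, w⟩ : TangentBundle I M)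
      = (extChartAt I P.proj P.proj, w) := by
    intro w
    refine Prod.ext rfl ?_
    change (trivializationAt E (TangentSpace I : M → Type _) P.proj ⟨P.proj, w⟩).2 = w
    exact (tangentBundleCore I M).coordChange_self _ _ (mem_chart_source H P.proj) w
  constructor
  · refine (FiberBundle.totalSpaceMk_isInducing E (TangentSpace I : M → Type _)
      P.proj).continuous.continuousAt
  · have h1 : HasFDerivWithinAt (fun w : E => (extChartAt I P.proj P.proj, w))
      (ContinuousLinearMap.inr ℝ E E) (range 𝓘(ℝ, E)) P.snd :=
        (hasFDerivAt_prodMk_right _ _).hasFDerivWithinAt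
    refine h1.congr_of_eventuallyEq ?_ ?_
    · exact Eventually.of_forall key
    · exact key _

lemma dproj_apply (P : TangentBundle I M) (ξ : TangentSpace I.tangent P) :
    dproj P ξ = (show E × E from ξ).1 := by
  unfold dproj
  rw [(hasMFDerivAt_proj P).mfderiv]
  rfl

lemma vlift_apply (P : TangentBundle I M) (b : TangentSpace I P.proj) :
    vlift P b = (show E × E from ((0 : E), b)) := by
  unfold vlift
  rw [(hasMFDerivAt_fiberIncl P).mfderiv]
  rfl

lemma connectionMap_apply (cov : CovariantDerivative I E (TangentSpace I : M → Type _))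
    (P : TangentBundle I M) (ξ : TangentSpace I.tangent P) :
    connectionMap cov P ξ = (show TangentSpace I P.proj from (show E × E from ξ).2) +
      cov (FiberBundle.extend E P.snd) P.proj (dproj P ξ) := by
  unfold connectionMap
  rw [(hasMFDerivAt_fiberCoord P).mfderiv]
  congr 1
  have h : ∀ w : E, (trivializationAt E (TangentSpace I : M → Type _) P.proj).symm P.proj w = w := by
    intro w
    have h1 : (trivializationAt E (TangentSpace I : M → Type _) P.proj ⟨P.proj, w⟩).2 = w :=
      (tangentBundleCore I M).coordChange_self _ _ (mem_chart_source H P.proj) w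
    have h2 := (trivializationAt E (TangentSpace I : M → Type _) P.proj).symm_apply_apply_mk
      (FiberBundle.mem_baseSet_trivializationAt' P.proj) w
    rwa [h1] at h2
  exact h _

lemma dproj_hlift (cov : CovariantDerivative I E (TangentSpace I : M → Type _))
    (P : TangentBundle I M) (a : TangentSpace I P.proj) : dproj P (hlift cov P a) = a := by
  rw [dproj_apply]; rfl

lemma connectionMap_hlift (cov : CovariantDerivative I E (TangentSpace I : M → Type _))
    (P : TangentBundle I M) (a : TangentSpace I P.proj) :
    connectionMap cov P (hlift cov P a) = 0 := by
  rw [connectionMap_apply, dproj_hlift]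
  exact neg_add_cancel (G := TangentSpace I P.proj) _

lemma dproj_vlift (P : TangentBundle I M) (b : TangentSpace I P.proj) :
    dproj P (vlift P b) = 0 := by
  rw [dproj_apply, vlift_apply]; rfl

lemma connectionMap_vlift (cov : CovariantDerivative I E (TangentSpace I : M → Type _))
    (P : TangentBundle I M) (b : TangentSpace I P.proj) :
    connectionMap cov P (vlift P b) = b := by
  rw [connectionMap_apply, dproj_vlift, map_zero, add_zero, vlift_apply]

/-- A tangent vector of `TM` is determined by its images under `dπ` and `K`. -/
lemma eq_of_dproj_of_connectionMap
    (cov : CovariantDerivative I E (TangentSpace I : M → Type _))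
    {P : TangentBundle I M} {ξ η : TangentSpace I.tangent P} (h : dproj P ξ = dproj P η)
    (h' : connectionMap cov P ξ = connectionMap cov P η) : ξ = η := by
  rw [connectionMap_apply, connectionMap_apply, h] at h'
  rw [dproj_apply, dproj_apply] at h
  exact Prod.ext h (add_right_cancel (G := TangentSpace I P.proj) h')

/-- The bilinear form `ḡ` on the tangent spaces of `TM` with `ḡ(X^h, Y^h) = m₁ g(X, Y)`,
`ḡ(X^h, Y^v) = m₂ g(X, Y)` and `ḡ(X^v, Y^v) = m₃ g(X, Y)`. -/
def liftMetric (g : ∀ x : M, TangentSpace I x → TangentSpace I x → ℝ)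
    (cov : CovariantDerivative I E (TangentSpace I : M → Type _)) (m₁ m₂ m₃ : ℝ)
    (P : TangentBundle I M) (ξ η : TangentSpace I.tangent P) : ℝ :=
  m₁ * g P.proj (dproj P ξ) (dproj P η)
    + m₂ * (g P.proj (dproj P ξ) (connectionMap cov P η)
      + g P.proj (connectionMap cov P ξ) (dproj P η))
    + m₃ * g P.proj (connectionMap cov P ξ) (connectionMap cov P η)

/-- The vector field `A^h + B^v` on `TM` for vector fields `A` and `B` on `M`. -/
def liftField (cov : CovariantDerivative I E (TangentSpace I : M → Type _))
    (A B : ∀ x : M, TangentSpace I x) (P : TangentBundle I M) : TangentSpace I.tangent P :=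
  hlift cov P (A P.proj) + vlift P (B P.proj)

/-- A smooth curve in `TM`, defined on the open set `s`, whose velocity is horizontal. -/
structure IsHorizontalCurveOn (cov : CovariantDerivative I E (TangentSpace I : M → Type _))
    (γ : ℝ → TangentBundle I M) (s : Set ℝ) : Prop where
  smooth : ContMDiffOn 𝓘(ℝ, ℝ) I.tangent ∞ γ s
  horizontal : ∀ t ∈ s,
    connectionMap cov (γ t) ((mfderiv 𝓘(ℝ, ℝ) I.tangent γ t : ℝ → TangentSpace I.tangent (γ t)) 1)
      = 0

/-- `Y = A^h + B^v + C + D` near `P`, where `A` and `B` are vector fields on `M` that are smooth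
near the base point of `P`, the vector field `C` is horizontal, the vector field `D` is vertical,
and `C` and `D` vanish at `P` and along horizontal curves through `P`, one for every
horizontal direction `a^h` at `P`. -/
structure IsDecompositionAt (cov : CovariantDerivative I E (TangentSpace I : M → Type _))
    (Y : ∀ Q : TangentBundle I M, TangentSpace I.tangent Q) (P : TangentBundle I M)
    (A B : ∀ x : M, TangentSpace I x)
    (C D : ∀ Q : TangentBundle I M, TangentSpace I.tangent Q) : Prop where
  smooth_left : CMDiffAt ∞ (T% A) P.proj
  smooth_right : CMDiffAt ∞ (T% B) P.proj
  eq_add : ∀ᶠ Q in 𝓝 P, Y Q = liftField cov A B Q + C Q + D Q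
  horizontal : ∀ᶠ Q in 𝓝 P, connectionMap cov Q (C Q) = 0
  vertical : ∀ᶠ Q in 𝓝 P, dproj Q (D Q) = 0
  left_eq_zero : C P = 0
  right_eq_zero : D P = 0
  vanish : ∀ a : TangentSpace I P.proj, ∃ ε : ℝ, 0 < ε ∧ ∃ γ : ℝ → TangentBundle I M,
    IsHorizontalCurveOn cov γ (Ioo (-ε) ε) ∧
    tangentMap 𝓘(ℝ, ℝ) I.tangent γ ⟨0, (1 : ℝ)⟩ = ⟨P, hlift cov P a⟩ ∧
    ∀ t ∈ Ioo (-ε) ε, C (γ t) = 0 ∧ D (γ t) = 0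

/-- The coordinates `(x, v)` on `TM` induced by a chart `φ` of `M`. -/
def inducedChart (φ : OpenPartialHomeomorph M H) (Q : TangentBundle I M) : E × E :=
  (φ.extend I Q.proj, mfderiv I 𝓘(ℝ, E) (φ.extend I) Q.proj Q.snd)

/-- The flat connection `∇̃` of the induced coordinates `(x, v)` on `TM`: the derivative, at `P` in
the direction `ξ`, of the components of the vector field `W` in these coordinates. -/
def flatDeriv (φ : OpenPartialHomeomorph M H)
    (W : ∀ Q : TangentBundle I M, TangentSpace I.tangent Q) (P : TangentBundle I M)
    (ξ : TangentSpace I.tangent P) : TangentSpace I.tangent P :=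
  (mfderiv I.tangent 𝓘(ℝ, E × E) (inducedChart (I := I) φ) P).inverse
    (mfderiv I.tangent 𝓘(ℝ, E × E) (fun Q : TangentBundle I M =>
      (mfderiv I.tangent 𝓘(ℝ, E × E) (inducedChart (I := I) φ) Q (W Q) : E × E)) P ξ)

end TangentLift

end

open TangentLift

/-! Existence. Transport `u` parallelly along the coordinate rays of a chart at `p`. This gives a
smooth local section `s` of `TM` with `s p = (p, u)` whose restriction to each ray is a horizontal
curve. Take for `A` and `B` the images under `dπ` and `K` of `Ȳ` along `s`, and let `C̄`, `D̄` be
the remaining horizontal and vertical parts of `Ȳ`. They vanish on the image of `s`, and the rays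
supply every horizontal direction at `(p, u)`. The analytic content is the smoothness of `s`: the
transport equations of all rays form one family of Volterra equations `(1 + L (N y)) v = u` in
`C([-1, 1], E)`, which depends smoothly on the endpoint `y` of the ray, and inversion of operators
is smooth (`exists_radially_parallel`).

Reduction to lifts. A vector field vanishing at a point has there the same derivative for every
connection, because two connections differ by a tensor. For `C̄ + D̄` this permits replacing the
Levi-Civita connection by the flat one, and the derivative in the direction `F^h` is zero since the
field vanishes along a curve with this velocity. Only the direction `G^v` remains
(`cov_eq_of_isDecompositionAt`).

The formula. Identify `T(TM)` with two copies of the pullback of `TM` by means of `(dπ, K)`. The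
pullback of `∇` on both copies is a connection preserving `ḡ`, as `ḡ` is a constant combination of
copies of `g`; its torsion is `(0, R(dπ ξ, dπ η) u)`. The Levi-Civita connection of `ḡ` therefore
differs from it by a tensor `τ`, skew for `ḡ`, whose antisymmetrization is minus this torsion. A
Koszul-type argument, the pair symmetry of `R` and a linear system of determinant proportional to
`Δ` determine `τ`: see `contorsion_eq`, and `coordLiftMetric_christoffel` for the version in
coordinates. On `A^h + B^v` the pullback connection yields `∇_F A` and `∇_F B`, and `τ` yields the
curvature terms (`cov_liftField`). -/

noncomputable section

/-! ### Radial parallel transport and its smoothness. -/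

section ParallelTransport

universe u

variable {E F W : Type u} [NormedAddCommGroup E] [NormedSpace ℝ E]
  [NormedAddCommGroup F] [NormedSpace ℝ F] [NormedAddCommGroup W] [NormedSpace ℝ W]
  {K : Type*} [TopologicalSpace K] [CompactSpace K]

/-- Evaluation of a continuous family of operators at a fixed vector. -/
def applyFamily (B : W →L[ℝ] E →L[ℝ] F)
    (K : Type*) [TopologicalSpace K] [CompactSpace K] :
    C(K, W) →L[ℝ] E →L[ℝ] C(K, F) :=
  LinearMap.mkContinuous₂
    (LinearMap.mk₂ ℝ (fun (g : C(K, W)) (h : E) =>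
        (⟨fun s => B (g s) h, by fun_prop⟩ : C(K, F)))
      (fun _ _ _ => by ext; simp) (fun _ _ _ => by ext; simp)
      (fun _ _ _ => by ext; simp) (fun _ _ _ => by ext; simp)) ‖B‖
    (fun g h => by
      rw [ContinuousMap.norm_le _ (by positivity)]
      intro s
      exact B.le_of_opNorm₂_le_of_le le_rfl (g.norm_coe_le_norm s) le_rfl)

/-- The family of sections of a jointly continuous function. -/
def sectionMap {E F K : Type*} [TopologicalSpace E] [TopologicalSpace F]
    [TopologicalSpace K] (f : E → K → F) (hf : Continuous (Function.uncurry f)) (y : E) : C(K, F) :=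
  ⟨f y, by fun_prop⟩

lemma continuous_sectionMap {E F K : Type*} [TopologicalSpace E] [TopologicalSpace F]
    [TopologicalSpace K] (f : E → K → F) (hf : Continuous (Function.uncurry f)) :
    Continuous (sectionMap f hf) :=
  (ContinuousMap.curry ⟨Function.uncurry f, hf⟩).continuous

/-- The mean value inequality is applied for each `s` on one ball around `y`. The estimate is
uniform in `s` because the sections of `f'` depend continuously on `y` in the sup norm. -/
lemma hasFDerivAt_sectionMap (B : W →L[ℝ] E →L[ℝ] F) (f : E → K → F)
    (hf : Continuous (Function.uncurry f))
    (f' : E → K → W) (hf' : Continuous (Function.uncurry f'))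
    (h : ∀ s y, HasFDerivAt (fun y => f y s) (B (f' y s)) y) (y : E) :
    HasFDerivAt (sectionMap f hf) (applyFamily B K (sectionMap f' hf' y)) y := by
  rw [hasFDerivAt_iff_isLittleO, Asymptotics.isLittleO_iff]
  intro ε hε
  -- The summand `1` keeps the quotient meaningful when `B = 0`.
  have hε' : 0 < ε / (‖B‖ + 1) := by positivity
  obtain ⟨δ, hδ, hball⟩ :=
    Metric.continuousAt_iff.1 (continuous_sectionMap f' hf').continuousAt (ε / (‖B‖ + 1)) hε'
  filter_upwards [Metric.ball_mem_nhds y hδ] with x hx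
  rw [ContinuousMap.norm_le _ (by positivity)]
  intro s
  refine (convex_ball y δ).norm_image_sub_le_of_norm_hasFDerivWithin_le'
    (f := fun y => f y s) (f' := fun y => B (f' y s)) (φ := B (f' y s))
    (fun z _ => (h s z).hasFDerivWithinAt) (fun z hz => ?_) (Metric.mem_ball_self hδ) hx
  have h1 := (ContinuousMap.dist_apply_le_dist s).trans (hball hz).le
  rw [dist_eq_norm] at h1
  rw [← map_sub]
  calc ‖B (f' z s - f' y s)‖ ≤ ‖B‖ * (ε / (‖B‖ + 1)) := B.le_of_opNorm_le_of_le le_rfl h1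
    _ ≤ (‖B‖ + 1) * (ε / (‖B‖ + 1)) := by gcongr; linarith
    _ = ε := by field_simp

/-- Induction on the order: the derivative of the section map is the section map of the partial
derivative, followed by the continuous linear map `applyFamily`. The target `F` varies in the
induction, being replaced by `E →L[ℝ] F`, so it must lie in the universe of `E`. As `K` is only a
topological space, smoothness in the parameter is expressed through `p : K → G`. -/
lemma contDiff_nat_sectionMap {G : Type*} [NormedAddCommGroup G] [NormedSpace ℝ G] {p : K → G}
    (hp : Continuous p) (n : ℕ) {F : Type u} [NormedAddCommGroup F] [NormedSpace ℝ F]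
    (f : E → G → F) (hf : ContDiff ℝ ∞ (Function.uncurry f)) :
    ContDiff ℝ n (sectionMap (fun y s => f y (p s))
      (hf.continuous.comp (continuous_fst.prodMk (hp.comp continuous_snd)))) := by
  induction n generalizing F with
  | zero => exact contDiff_zero.2 (continuous_sectionMap _ _)
  | succ n ih =>
    have hf' : ContDiff ℝ ∞ (Function.uncurry fun (y : E) (t : G) => fderiv ℝ (fun y => f y t) y) := by
      have : ContDiff ℝ ∞ (Function.uncurry fun (q : E × G) (y : E) => f y q.2) :=
        hf.comp (contDiff_snd.prodMk (contDiff_snd.comp contDiff_fst))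
      exact this.fderiv contDiff_fst le_rfl
    refine contDiff_succ_iff_hasFDerivAt.2 ⟨_,
      (applyFamily (ContinuousLinearMap.id ℝ (E →L[ℝ] F)) K).contDiff.comp (ih _ hf'), fun y => ?_⟩
    refine hasFDerivAt_sectionMap (ContinuousLinearMap.id ℝ (E →L[ℝ] F)) _ _ _ _ (fun s y => ?_) y
    have : ContDiff ℝ ∞ fun y => f y (p s) := hf.comp (contDiff_id.prodMk contDiff_const)
    exact (this.differentiable (by simp) y).hasFDerivAt

lemma contDiff_sectionMap {G : Type*} [NormedAddCommGroup G] [NormedSpace ℝ G] {p : K → G}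
    (hp : Continuous p) (f : E → G → F) (hf : ContDiff ℝ ∞ (Function.uncurry f)) :
    ContDiff ℝ ∞ (sectionMap (fun y s => f y (p s))
      (hf.continuous.comp (continuous_fst.prodMk (hp.comp continuous_snd)))) :=
  contDiff_infty.2 fun n => contDiff_nat_sectionMap hp n f hf

/-- `1 + L (N y)` is the identity at `y = 0`. Invertible operators form an open set on which
inversion is smooth. The uniqueness clause is what later gives the scaling property of solutions. -/
lemma exists_contDiffOn_solution {X Y : Type*} [NormedAddCommGroup X] [NormedSpace ℝ X]
    [CompleteSpace X] [NormedAddCommGroup Y] [NormedSpace ℝ Y] (L : Y →L[ℝ] X →L[ℝ] X)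
    {N : E → Y} (hN : ContDiff ℝ ∞ N) (hN0 : N 0 = 0) (c : X) :
    ∃ r > 0, ∃ V : E → X, ContDiffOn ℝ ∞ V (Metric.ball 0 r) ∧
      ∀ y ∈ Metric.ball (0 : E) r, V y + L (N y) (V y) = c ∧ ∀ v, v + L (N y) v = c → v = V y := by
  set T : E → X →L[ℝ] X := fun y => 1 + L (N y) with hT
  have hTsm : ContDiff ℝ ∞ T := contDiff_const.add (L.contDiff.comp hN)
  have hT0 : T 0 = 1 := by simp [hT, hN0]
  obtain ⟨r, hr, hunit⟩ : ∃ r > 0, ∀ y ∈ Metric.ball (0 : E) r, IsUnit (T y) := by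
    have : {x | IsUnit x} ∈ 𝓝 (T 0) := Units.isOpen.mem_nhds (by rw [hT0]; exact isUnit_one)
    exact Metric.mem_nhds_iff.1 (hTsm.continuous.continuousAt this)
  refine ⟨r, hr, fun y => Ring.inverse (T y) c, ?_, fun y hy => ⟨?_, fun v hv => ?_⟩⟩
  · intro y hy
    obtain ⟨x, hx⟩ := hunit y hy
    have h2 := contDiffAt_ringInverse ℝ (n := ∞) x
    rw [hx] at h2
    exact ((h2.comp y hTsm.contDiffAt).clm_apply contDiffAt_const).contDiffWithinAt
  · exact DFunLike.congr_fun (Ring.mul_inverse_cancel (T y) (hunit y hy)) c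
  · rw [← hv]
    exact (DFunLike.congr_fun (Ring.inverse_mul_cancel (T y) (hunit y hy)) v).symm

variable [CompleteSpace E]

/-- The operator `v ↦ (t ↦ ∫₀ᵗ g v)` on continuous functions on `[-1, 1]`. -/
def volterra (B : W →L[ℝ] E →L[ℝ] E) :
    C(Icc (-1 : ℝ) 1, W) →L[ℝ] C(Icc (-1 : ℝ) 1, E) →L[ℝ] C(Icc (-1 : ℝ) 1, E) :=
  have h1 : (-1 : ℝ) ≤ 1 := by norm_num
  -- Constant extension beyond `[-1, 1]` makes the integrand continuous on `ℝ`, so that interval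
  -- integrals need no side conditions.
  have hc : ∀ (g : C(Icc (-1 : ℝ) 1, W)) (v : C(Icc (-1 : ℝ) 1, E)),
      Continuous (IccExtend h1 (fun s => B (g s) (v s))) := fun g v =>
    ((B.continuous.comp g.continuous).clm_apply v.continuous).Icc_extend'
  LinearMap.mkContinuous₂
    (LinearMap.mk₂ ℝ (fun (g : C(Icc (-1 : ℝ) 1, W)) (v : C(Icc (-1 : ℝ) 1, E)) =>
        (⟨fun t => ∫ s in (0 : ℝ)..t, IccExtend h1 (fun s => B (g s) (v s)) s,
          (intervalIntegral.continuous_primitive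
            (fun a b => (hc g v).intervalIntegrable a b) 0).comp continuous_subtype_val⟩ :
          C(Icc (-1 : ℝ) 1, E)))
      (fun g g' v => by
        ext t
        simp only [ContinuousMap.coe_mk, ContinuousMap.add_apply]
        rw [← intervalIntegral.integral_add ((hc g v).intervalIntegrable _ _)
          ((hc g' v).intervalIntegrable _ _)]
        simp [IccExtend])
      (fun c g v => by
        ext t
        simp only [ContinuousMap.coe_mk, ContinuousMap.smul_apply]
        rw [← intervalIntegral.integral_smul]
        simp [IccExtend])
      (fun g v v' => by
        ext t
        simp only [ContinuousMap.coe_mk, ContinuousMap.add_apply]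
        rw [← intervalIntegral.integral_add ((hc g v).intervalIntegrable _ _)
          ((hc g v').intervalIntegrable _ _)]
        simp [IccExtend])
      (fun c g v => by
        ext t
        simp only [ContinuousMap.coe_mk, ContinuousMap.smul_apply]
        rw [← intervalIntegral.integral_smul]
        simp [IccExtend])) ‖B‖
    (fun g v => by
      rw [ContinuousMap.norm_le _ (by positivity)]
      intro t
      refine (intervalIntegral.norm_integral_le_of_norm_le_const
        (C := ‖B‖ * ‖g‖ * ‖v‖) fun s _ => ?_).trans ?_
      · exact B.le_of_opNorm₂_le_of_le le_rfl (g.norm_coe_le_norm _) (v.norm_coe_le_norm _)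
      · have : |(t : ℝ) - 0| ≤ 1 := by rw [sub_zero, abs_le]; exact t.2
        exact mul_le_of_le_one_right (by positivity) this)

set_option linter.unusedSectionVars false in
lemma volterra_apply (B : W →L[ℝ] E →L[ℝ] E) (g : C(Icc (-1 : ℝ) 1, W))
    (v : C(Icc (-1 : ℝ) 1, E)) (t : Icc (-1 : ℝ) 1) :
    volterra B g v t = ∫ s in (0 : ℝ)..t,
      IccExtend (by norm_num : (-1 : ℝ) ≤ 1) (fun s => B (g s) (v s)) s := rfl

/-- Smooth dependence on parameters for parallel transport along the rays from `z₀`. -/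
theorem exists_radially_parallel (B : W →L[ℝ] E →L[ℝ] E) (Γ : E → E →L[ℝ] W)
    (hΓ : ContDiff ℝ ∞ Γ) (z₀ u : E) :
    ∃ r > 0, ∃ U : E → E, ContDiffOn ℝ ∞ U (Metric.ball z₀ r) ∧ U z₀ = u ∧
      ∀ (a : E) (t : ℝ), ‖t • a‖ < r →
        fderiv ℝ U (z₀ + t • a) a = - B (Γ (z₀ + t • a) a) (U (z₀ + t • a)) := by
  have h1 : (-1 : ℝ) ≤ 1 := by norm_num
  have h1m : (1 : ℝ) ∈ Icc (-1 : ℝ) 1 := by simp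
  -- Parallel transport along `s ↦ z₀ + s • y` is the linear equation `v' = -B (f y s) v`. The
  -- two-sided interval `[-1, 1]` keeps `s = 0` in the interior.
  set f : E → ℝ → W := fun y s => Γ (z₀ + s • y) y with hfdef
  have hf : ContDiff ℝ ∞ (Function.uncurry f) :=
    (hΓ.comp (contDiff_const.add (contDiff_snd.smul contDiff_fst))).clm_apply contDiff_fst
  set N : E → C(Icc (-1 : ℝ) 1, W) := sectionMap (fun y s => f y (s : ℝ))
    (hf.continuous.comp (continuous_fst.prodMk (continuous_subtype_val.comp continuous_snd)))
    with hN
  have hNsm : ContDiff ℝ ∞ N := contDiff_sectionMap continuous_subtype_val f hf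
  obtain ⟨r, hr, V, hVsm, hV⟩ := exists_contDiffOn_solution (volterra B) hNsm
    (by ext s; simp [hN, sectionMap, hfdef]) (ContinuousMap.const _ u)
  have hcont : ∀ (y : E) (v : C(Icc (-1 : ℝ) 1, E)),
      Continuous fun s => B (f y s) (IccExtend h1 v s) := fun y v =>
    (B.continuous.comp (hf.continuous.comp (continuous_const.prodMk continuous_id))).clm_apply
      (v.continuous.Icc_extend')
  have hTv : ∀ (y : E) (v : C(Icc (-1 : ℝ) 1, E)) (t : ℝ) (ht : t ∈ Icc (-1 : ℝ) 1),
      (v + volterra B (N y) v) ⟨t, ht⟩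
        = IccExtend h1 v t + ∫ s in (0 : ℝ)..t, B (f y s) (IccExtend h1 v s) := by
    intro y v t ht
    rw [ContinuousMap.add_apply, volterra_apply, IccExtend_of_mem h1 v ht]
    congr 1
    refine intervalIntegral.integral_congr fun s hs => ?_
    have hs' : s ∈ Icc (-1 : ℝ) 1 :=
      (convex_Icc (-1 : ℝ) 1).ordConnected.uIcc_subset (by simp) ht hs
    simp only [IccExtend_of_mem h1 _ hs']
    rfl
  -- The solution as an integral equation on the real line, from which the differential equation is
  -- recovered below.
  have hint : ∀ y ∈ Metric.ball (0 : E) r, ∀ t ∈ Icc (-1 : ℝ) 1,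
      IccExtend h1 (V y) t = u - ∫ s in (0 : ℝ)..t, B (f y s) (IccExtend h1 (V y) s) := by
    intro y hy t ht
    rw [eq_sub_iff_add_eq, ← hTv y _ t ht, (hV y hy).1]
    rfl
  -- Rescaling the ray: `s ↦ V y (τ s)` solves the equation with parameter `τ • y`, so uniqueness
  -- identifies it with `V (τ • y)`. Hence the values at time `1` contain the whole solution along
  -- each ray.
  have hscale : ∀ y ∈ Metric.ball (0 : E) r, ∀ τ ∈ Icc (-1 : ℝ) 1,
      V (τ • y) ⟨1, h1m⟩ = IccExtend h1 (V y) τ := by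
    intro y hy τ hτ
    have hτ' : |τ| ≤ 1 := abs_le.2 hτ
    have hy' : τ • y ∈ Metric.ball (0 : E) r := by
      rw [mem_ball_zero_iff] at hy ⊢
      rw [norm_smul, Real.norm_eq_abs]
      nlinarith [norm_nonneg y]
    have hmem : ∀ s ∈ Icc (-1 : ℝ) 1, τ * s ∈ Icc (-1 : ℝ) 1 := fun s hs => by
      rw [mem_Icc, ← abs_le, abs_mul]
      exact mul_le_one₀ hτ' (abs_nonneg _) (abs_le.2 hs)
    set w : C(Icc (-1 : ℝ) 1, E) := ⟨fun s => V y ⟨τ * s, hmem s s.2⟩, by fun_prop⟩ with hw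
    have hwv : ∀ s ∈ Icc (-1 : ℝ) 1, IccExtend h1 w s = IccExtend h1 (V y) (τ * s) := by
      intro s hs
      rw [IccExtend_of_mem h1 _ hs, IccExtend_of_mem h1 _ (hmem s hs)]
      rfl
    have : w = V (τ • y) := by
      refine (hV _ hy').2 w ?_
      ext ⟨t, ht⟩
      rw [hTv, hwv t ht, hint y hy _ (hmem t ht)]
      have h3 : ∫ s in (0 : ℝ)..t, B (f (τ • y) s) (IccExtend h1 w s)
          = ∫ s in (0 : ℝ)..t, τ • B (f y (τ * s)) (IccExtend h1 (V y) (τ * s)) := by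
        refine intervalIntegral.integral_congr fun s hs => ?_
        have hs' : s ∈ Icc (-1 : ℝ) 1 :=
          (convex_Icc (-1 : ℝ) 1).ordConnected.uIcc_subset (by simp) ht hs
        have h4 : f (τ • y) s = τ • f y (τ * s) := by
          simp only [hfdef, smul_smul, map_smul, mul_comm τ s]
        simp only [h4, hwv s hs', map_smul, smul_apply]
      rw [h3, intervalIntegral.integral_smul, intervalIntegral.smul_integral_comp_mul_left
        (fun s => B (f y s) (IccExtend h1 (V y) s)), mul_zero, sub_add_cancel]
      rfl
    rw [← this, IccExtend_of_mem h1 _ hτ]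
    simp [hw]
  set U : E → E := fun z => V (z - z₀) ⟨1, h1m⟩ with hU
  have hUsm : ContDiffOn ℝ ∞ U (Metric.ball z₀ r) := by
    have h2 : ContDiffOn ℝ ∞ (fun z => V (z - z₀)) (Metric.ball z₀ r) :=
      hVsm.comp (contDiff_id.sub contDiff_const).contDiffOn
        (fun z hz => by simpa [dist_eq_norm] using hz)
    exact (ContinuousMap.evalCLM ℝ (⟨1, h1m⟩ : Icc (-1 : ℝ) 1)).contDiff.comp_contDiffOn h2
  have hUray : ∀ y ∈ Metric.ball (0 : E) r, ∀ t ∈ Icc (-1 : ℝ) 1,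
      U (z₀ + t • y) = IccExtend h1 (V y) t := by
    intro y hy t ht
    rw [← hscale y hy t ht]
    simp [hU]
  refine ⟨r, hr, U, hUsm, ?_, ?_⟩
  · have h0 : (0 : E) ∈ Metric.ball (0 : E) r := Metric.mem_ball_self hr
    have h2 := hUray 0 h0 0 (by simp)
    rw [hint 0 h0 0 (by simp)] at h2
    simpa using h2
  · intro a t hat
    rcases eq_or_ne a 0 with rfl | ha
    · simp
    -- The ray is run with velocity `l • a`, where `l` is large enough for `t / l` to be interior to
    -- `[-1, 1]` and small enough for `l • a` to stay in the ball.
    obtain ⟨l, hl1, hl2⟩ : ∃ l, |t| < l ∧ l < r / ‖a‖ := by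
      apply exists_between
      rw [lt_div_iff₀ (norm_pos_iff.2 ha)]
      rwa [norm_smul] at hat
    have hl : 0 < l := (abs_nonneg t).trans_lt hl1
    have hy : l • a ∈ Metric.ball (0 : E) r := by
      rw [mem_ball_zero_iff, norm_smul, Real.norm_eq_abs, abs_of_pos hl]
      exact (lt_div_iff₀ (norm_pos_iff.2 ha)).1 hl2
    have htl : t / l ∈ Ioo (-1 : ℝ) 1 := by
      rw [mem_Ioo, ← abs_lt, abs_div, abs_of_pos hl, div_lt_one hl]
      exact hl1
    have hz : z₀ + (t / l) • l • a = z₀ + t • a := by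
      rw [smul_smul, div_mul_cancel₀ _ hl.ne']
    have hd1 : HasDerivAt (IccExtend h1 (V (l • a)))
        (- B (f (l • a) (t / l)) (IccExtend h1 (V (l • a)) (t / l))) (t / l) := by
      have h2 := (((hcont (l • a) (V (l • a))).integral_hasStrictDerivAt 0
        (t / l)).hasDerivAt).const_sub u
      refine h2.congr_of_eventuallyEq ?_
      filter_upwards [Ioo_mem_nhds htl.1 htl.2] with s hs
      exact hint _ hy s (Ioo_subset_Icc_self hs)
    have hd2 : HasDerivAt (fun s : ℝ => U (z₀ + s • l • a))
        (fderiv ℝ U (z₀ + t • a) (l • a)) (t / l) := by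
      have h3 : HasFDerivAt U (fderiv ℝ U (z₀ + t • a)) (z₀ + (t / l) • l • a) := by
        rw [hz]
        refine ((hUsm.differentiableOn (by simp)).differentiableAt
          (Metric.isOpen_ball.mem_nhds ?_)).hasFDerivAt
        simpa using hat
      have h4 : HasDerivAt (fun s : ℝ => z₀ + s • l • a) (l • a) (t / l) := by
        simpa using ((hasDerivAt_id (t / l)).smul_const (l • a)).const_add z₀
      exact h3.comp_hasDerivAt _ h4
    have hd3 : HasDerivAt (fun s : ℝ => U (z₀ + s • l • a))
        (- B (f (l • a) (t / l)) (IccExtend h1 (V (l • a)) (t / l))) (t / l) := by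
      refine hd1.congr_of_eventuallyEq ?_
      filter_upwards [Ioo_mem_nhds htl.1 htl.2] with s hs
      exact hUray _ hy s (Ioo_subset_Icc_self hs)
    -- The derivative along the ray is computed by the chain rule and by the fundamental theorem of
    -- calculus; the common factor `l` is then cancelled.
    have h5 := hd2.unique hd3
    rw [← hUray _ hy _ (Ioo_subset_Icc_self htl), hz] at h5
    simp only [hfdef, hz, map_smul, smul_apply, ← smul_neg] at h5
    exact smul_right_injective E hl.ne' h5

set_option linter.unusedSectionVars false in
lemma ContDiffBump.contDiff_smul [FiniteDimensional ℝ E] {z₀ : E} (χ : ContDiffBump z₀)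
    {s : Set E} (hs : IsOpen s) (hball : Metric.closedBall z₀ χ.rOut ⊆ s)
    {f : E → F} (hf : ContDiffOn ℝ ∞ f s) : ContDiff ℝ ∞ (fun z => χ z • f z) := by
  rw [contDiff_iff_contDiffAt]
  intro z
  by_cases hzs : z ∈ s
  · exact χ.contDiffAt.smul (hf.contDiffAt (hs.mem_nhds hzs))
  · have h0 : (fun z => χ z • f z) =ᶠ[𝓝 z] fun _ => 0 := by
      have : z ∉ tsupport χ := by
        rw [χ.tsupport_eq]
        exact fun h => hzs (hball h)
      filter_upwards [notMem_tsupport_iff_eventuallyEq.1 this] with y hy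
      rw [hy]
      exact zero_smul ℝ _
    exact contDiffAt_const.congr_of_eventuallyEq h0

/-- Parallel transport along the rays from `z₀` for Christoffel symbols smooth near `z₀`. -/
theorem exists_radially_parallel_of_contDiffOn [FiniteDimensional ℝ E] (B : W →L[ℝ] E →L[ℝ] E)
    {Γ : E → E →L[ℝ] W} {s : Set E} (hs : IsOpen s) (hΓ : ContDiffOn ℝ ∞ Γ s)
    {z₀ : E} (hz : z₀ ∈ s) (u : E) :
    ∃ r > 0, Metric.ball z₀ r ⊆ s ∧ ∃ U : E → E, ContDiffOn ℝ ∞ U (Metric.ball z₀ r) ∧ U z₀ = u ∧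
      ∀ (a : E) (t : ℝ), ‖t • a‖ < r →
        fderiv ℝ U (z₀ + t • a) a = - B (Γ (z₀ + t • a) a) (U (z₀ + t • a)) := by
  obtain ⟨ρ, hρ, hball⟩ := Metric.isOpen_iff.1 hs z₀ hz
  -- The cutoff makes the Christoffel symbols globally smooth and leaves them unchanged within
  -- distance `ρ / 3`, which bounds the final radius.
  let χ : ContDiffBump z₀ := ⟨ρ / 3, ρ / 2, by positivity, by linarith⟩
  have hsm : ContDiff ℝ ∞ (fun z => χ z • Γ z) := χ.contDiff_smul hs
    ((Metric.closedBall_subset_ball (by change ρ / 2 < ρ; linarith)).trans hball) hΓ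
  obtain ⟨r, hr, U, hU, hUz, hUd⟩ := exists_radially_parallel B _ hsm z₀ u
  refine ⟨min r (ρ / 3), lt_min hr (by positivity),
    (Metric.ball_subset_ball ((min_le_right _ _).trans (by linarith))).trans hball, U,
    hU.mono (Metric.ball_subset_ball (min_le_left _ _)), hUz, fun a t hat => ?_⟩
  have h1 : χ (z₀ + t • a) = 1 := χ.one_of_mem_closedBall (by
    rw [mem_closedBall_iff_norm, add_sub_cancel_left]
    exact (hat.trans_le (min_le_right _ _)).le)
  simpa [h1] using hUd a t (hat.trans_le (min_le_left _ _))

end ParallelTransport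

/-! ### Algebra of the curvature tensor and the contorsion. -/

section LinearAlgebra

variable {E : Type*} [NormedAddCommGroup E] [NormedSpace ℝ E]

/-- The classical argument: add the four Bianchi identities with one of the arguments omitted, and
cancel by the two skew symmetries. No linearity of `R` is needed. -/
lemma curvature_pair_symm (G : E →L[ℝ] E →L[ℝ] ℝ) (R : E → E → E → E)
    (hanti : ∀ a b c, R a b c = - R b a c)
    (hbianchi : ∀ a b c, R a b c + R b c a + R c a b = 0)
    (hskew : ∀ a b c d, G (R a b c) d = - G (R a b d) c) (a b c d : E) :
    G (R a b c) d = G (R c d a) b := by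
  have hA : ∀ a b c d, G (R a b c) d = - G (R b a c) d := fun a b c d => by
    rw [hanti a b c]; simp
  have hB : ∀ a b c d, G (R a b c) d + G (R b c a) d + G (R c a b) d = 0 := fun a b c d => by
    have := congrArg (fun w => G w d) (hbianchi a b c)
    simpa using this
  linarith [hB a b c d, hB b c d a, hB c d a b, hB d a b c, hA a b c d, hA b c a d, hA c a b d,
    hskew a b c d, hskew b c a d, hskew c a b d, hskew b c d a, hskew c d b a, hskew d b c a,
    hskew c d a b, hskew d a c b, hskew a c d b, hskew d a b c, hskew a b d c, hskew b d a c,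
    hA c a d b, hA a c d b, hA b d a c, hA d b a c, hA c d a b, hA d a b c, hA c a b d,
    hA b d c a]

/-- The difference of two metric connections on the total space, expressed in terms of the
torsion `(0, R(a, b) v)` of the second one. -/
lemma contorsion_eq (G : E →L[ℝ] E →L[ℝ] ℝ) (hsymm : ∀ a b, G a b = G b a)
    (hnd : ∀ a, (∀ b, G a b = 0) → a = 0) (R : E → E → E → E)
    (hanti : ∀ a b c, R a b c = - R b a c)
    (hbianchi : ∀ a b c, R a b c + R b c a + R c a b = 0)
    (hskew : ∀ a b c d, G (R a b c) d = - G (R a b d) c)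
    {m₁ m₂ m₃ : ℝ} (hm : m₁ * m₃ - m₂ ^ 2 ≠ 0)
    (v : E) (τ : E × E → E × E → E × E) (gT : E × E → E × E → ℝ)
    (hg : ∀ ξ η, gT ξ η = m₁ * G ξ.1 η.1 + m₂ * (G ξ.1 η.2 + G ξ.2 η.1) + m₃ * G ξ.2 η.2)
    (hmetric : ∀ ξ η ζ, gT (τ ξ η) ζ + gT η (τ ξ ζ) = 0)
    (htors : ∀ ξ η, τ ξ η - τ η ξ = - (0, R ξ.1 η.1 v)) (a β c δ : E) :
    (τ (a, β) (c, δ)).1 = (m₁ * m₃ - m₂ ^ 2)⁻¹ • ((m₂ * m₃) • R v a c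
        + (m₂ * m₃ / 2) • R a c v + (m₃ ^ 2 / 2) • R v δ a + (m₃ ^ 2 / 2) • R v β c) ∧
    (τ (a, β) (c, δ)).2 = (m₁ * m₃ - m₂ ^ 2)⁻¹ • (-(m₂ ^ 2) • R v a c
        - (m₁ * m₃ / 2) • R a c v - (m₂ * m₃ / 2) • R v δ a - (m₂ * m₃ / 2) • R v β c) := by
  have hpair := curvature_pair_symm G R hanti hbianchi hskew
  have hgs : ∀ ξ η, gT ξ η = gT η ξ := fun ξ η => by
    rw [hg, hg, hsymm ξ.1, hsymm ξ.1, hsymm ξ.2, hsymm ξ.2]; ring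
  -- The Koszul trick: skewness of `τ` for three cyclic arrangements, with antisymmetrizations
  -- replaced by the torsion.
  have key : ∀ ζ : E × E, 2 * gT (τ (a, β) (c, δ)) ζ
      = - gT (0, R a c v) ζ + gT (0, R c ζ.1 v) (a, β) + gT (0, R a ζ.1 v) (c, δ) := by
    intro ζ
    have hsub : ∀ ξ η ζ, gT (τ ξ η) ζ - gT (τ η ξ) ζ = - gT (0, R ξ.1 η.1 v) ζ := by
      intro ξ η ζ
      have h1 := htors ξ η
      have h2 : τ ξ η = τ η ξ - (0, R ξ.1 η.1 v) := by rw [sub_eq_add_neg, ← h1]; abel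
      rw [h2]
      simp only [hg, Prod.fst_sub, Prod.snd_sub, map_sub, sub_apply, map_zero, zero_apply,
        sub_zero]
      ring
    linarith [hmetric (a, β) (c, δ) ζ, hmetric (c, δ) (a, β) ζ, hmetric ζ (a, β) (c, δ),
      hsub (a, β) (c, δ) ζ, hsub (c, δ) ζ (a, β), hsub (a, β) ζ (c, δ),
      hgs (c, δ) (τ (a, β) ζ), hgs (a, β) (τ (c, δ) ζ), hgs (a, β) (τ ζ (c, δ))]
  -- Testing against horizontal vectors `(b, 0)`. Pair symmetry moves `b` out of the curvature, so
  -- that nondegeneracy of `G` applies.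
  have e1 : (2 * m₁) • (τ (a, β) (c, δ)).1 + (2 * m₂) • (τ (a, β) (c, δ)).2
      = -(m₂ • R a c v) + (m₂ • R v a c + m₃ • R v β c) + (m₂ • R v c a + m₃ • R v δ a) := by
    rw [← sub_eq_zero]
    refine hnd _ fun b => ?_
    have h1 := key (b, 0)
    simp only [hg, map_zero, zero_apply, hpair c b v, hpair a b v] at h1
    simp only [map_sub, map_add, map_neg, map_smul, sub_apply, add_apply, neg_apply,
      smul_apply, smul_eq_mul]
    linarith
  have e2 : (2 * m₂) • (τ (a, β) (c, δ)).1 + (2 * m₃) • (τ (a, β) (c, δ)).2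
      = -(m₃ • R a c v) := by
    rw [← sub_eq_zero]
    refine hnd _ fun b => ?_
    -- Against vertical vectors `(0, b)` the last two torsion terms vanish: by pair symmetry `G (R c
    -- 0 v) w = G (R v w c) 0 = 0`.
    have h1 := key (0, b)
    simp only [hg, map_zero, zero_apply, hpair c 0 v, hpair a 0 v] at h1
    simp only [map_sub, map_add, map_neg, map_smul, sub_apply, add_apply, neg_apply,
      smul_apply, smul_eq_mul]
    linarith
  have e3 : R v c a = R v a c + R a c v := by
    have h1 := hbianchi v a c
    rw [hanti c v a] at h1
    rw [← sub_eq_zero, ← neg_eq_zero, ← h1]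
    abel
  rw [e3] at e1
  generalize τ (a, β) (c, δ) = t at e1 e2 ⊢
  -- `e1` and `e2` form a linear system with matrix `2 (m₁, m₂; m₂, m₃)`, solved by Cramer's rule.
  constructor
  · rw [eq_inv_smul_iff₀ hm]
    linear_combination (norm := module) (m₃ / 2) • e1 - (m₂ / 2) • e2
  · rw [eq_inv_smul_iff₀ hm]
    linear_combination (norm := module) (m₁ / 2) • e2 - (m₂ / 2) • e1

end LinearAlgebra

/-! ### Curvature and the lifted metric in coordinates. -/

section CoordinateCalculus

set_option synthInstance.maxHeartbeats 200000

variable {E : Type*} [NormedAddCommGroup E] [NormedSpace ℝ E]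

/-- The curvature tensor of the connection with Christoffel symbols `Γ` on a vector space. -/
def coordCurvature (Γ : E → E →L[ℝ] E →L[ℝ] E) (z a b c : E) : E :=
  fderiv ℝ Γ z a b c - fderiv ℝ Γ z b a c + Γ z a (Γ z b c) - Γ z b (Γ z a c)

lemma coordCurvature_anti (Γ : E → E →L[ℝ] E →L[ℝ] E) (z a b c : E) :
    coordCurvature Γ z a b c = - coordCurvature Γ z b a c := by
  simp only [coordCurvature]; abel

lemma hasFDerivAt_bilin {X F W : Type*} [NormedAddCommGroup X] [NormedSpace ℝ X]
    [NormedAddCommGroup F] [NormedSpace ℝ F] [NormedAddCommGroup W] [NormedSpace ℝ W]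
    {G : X → E →L[ℝ] F →L[ℝ] W} {G' : X →L[ℝ] E →L[ℝ] F →L[ℝ] W} {f : X → E} {f' : X →L[ℝ] E}
    {h : X → F} {h' : X →L[ℝ] F} {x : X} (hG : HasFDerivAt G G' x) (hf : HasFDerivAt f f' x)
    (hh : HasFDerivAt h h' x) :
    ∃ D : X →L[ℝ] W, HasFDerivAt (fun y => G y (f y) (h y)) D x ∧
      ∀ ξ, D ξ = G' ξ (f x) (h x) + G x (f' ξ) (h x) + G x (f x) (h' ξ) := by
  refine ⟨_, (hG.clm_apply hf).clm_apply hh, fun ξ => ?_⟩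
  simp
  abel

lemma fderiv_symm_of_eventually {Γ : E → E →L[ℝ] E →L[ℝ] E} {z : E} (hd : DifferentiableAt ℝ Γ z)
    (hs : ∀ᶠ y in 𝓝 z, ∀ a b, Γ y a b = Γ y b a) (a b c : E) :
    fderiv ℝ Γ z a b c = fderiv ℝ Γ z a c b := by
  have h := fun b c => (hd.hasFDerivAt.clm_apply (hasFDerivAt_const b z)).clm_apply
    (hasFDerivAt_const c z)
  have h2 := (h c b).congr_of_eventuallyEq
    (show (fun y => Γ y b c) =ᶠ[𝓝 z] fun y => Γ y c b by filter_upwards [hs] with y hy using hy b c)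
  have h3 := congrArg (fun D => D a) ((h b c).unique h2)
  simpa using h3

lemma coordCurvature_bianchi {Γ : E → E →L[ℝ] E →L[ℝ] E} {z : E} (hd : DifferentiableAt ℝ Γ z)
    (hs : ∀ᶠ y in 𝓝 z, ∀ a b, Γ y a b = Γ y b a) (a b c : E) :
    coordCurvature Γ z a b c + coordCurvature Γ z b c a + coordCurvature Γ z c a b = 0 := by
  simp only [coordCurvature, fderiv_symm_of_eventually hd hs a c b,
    fderiv_symm_of_eventually hd hs b a c, fderiv_symm_of_eventually hd hs c b a,
    hs.self_of_nhds b a, hs.self_of_nhds c a, hs.self_of_nhds c b]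
  abel

/-- `D_a (G (b, c)) = G (Γ (a, b), c) + G (b, Γ (a, c))`. -/
def IsMetricCoord (G : E → E →L[ℝ] E →L[ℝ] ℝ) (Γ : E → E →L[ℝ] E →L[ℝ] E) (z : E) : Prop :=
  ∀ a b c, fderiv ℝ G z a b c = G z (Γ z a b) c + G z b (Γ z a c)

/-- Symmetry of the second derivatives of `G c d`: differentiating the metric condition once more
and exchanging `a` and `b` leaves exactly the curvature terms. -/
lemma coordCurvature_skew {Γ : E → E →L[ℝ] E →L[ℝ] E} {G : E → E →L[ℝ] E →L[ℝ] ℝ} {z : E}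
    (hd : DifferentiableAt ℝ Γ z) (hG : ContDiffAt ℝ 2 G z)
    (hmet : ∀ᶠ y in 𝓝 z, IsMetricCoord G Γ y) (a b c d : E) :
    G z (coordCurvature Γ z a b c) d + G z c (coordCurvature Γ z a b d) = 0 := by
  have hGd : DifferentiableAt ℝ G z := hG.differentiableAt (by simp)
  have hf : ContDiffAt ℝ 2 (fun y => G y c d) z :=
    (hG.clm_apply contDiffAt_const).clm_apply contDiffAt_const
  have hf' : ∀ b, (fun y => fderiv ℝ (fun y => G y c d) y b)
      =ᶠ[𝓝 z] fun y => G y (Γ y b c) d + G y c (Γ y b d) := by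
    intro b
    have h1 : ∀ᶠ y in 𝓝 z, ContDiffAt ℝ 2 G y := hG.eventually (by simp)
    filter_upwards [hmet, h1] with y hy h1y
    obtain ⟨D, hD, hD'⟩ := hasFDerivAt_bilin (h1y.differentiableAt (by simp)).hasFDerivAt
      (hasFDerivAt_const c y) (hasFDerivAt_const d y)
    rw [hD.fderiv, hD', hy b c d]
    simp
  have hfd : DifferentiableAt ℝ (fderiv ℝ (fun y => G y c d)) z :=
    (hf.fderiv_right (m := 1) (by norm_num)).differentiableAt (by simp)
  have hsymm := (hf.isSymmSndFDerivAt (by simp)) a b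
  have hm := hmet.self_of_nhds
  have key : ∀ a b, fderiv ℝ (fderiv ℝ (fun y => G y c d)) z a b
      = (fderiv ℝ G z a (Γ z b c) d + G z (fderiv ℝ Γ z a b c) d)
        + (fderiv ℝ G z a c (Γ z b d) + G z c (fderiv ℝ Γ z a b d)) := by
    intro a b
    have hΓ : ∀ c, HasFDerivAt (fun y => Γ y b c) _ z := fun c =>
      (hd.hasFDerivAt.clm_apply (hasFDerivAt_const b z)).clm_apply (hasFDerivAt_const c z)
    obtain ⟨D1, h1, h1'⟩ := hasFDerivAt_bilin hGd.hasFDerivAt (hΓ c) (hasFDerivAt_const d z)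
    obtain ⟨D2, h2, h2'⟩ := hasFDerivAt_bilin hGd.hasFDerivAt (hasFDerivAt_const c z) (hΓ d)
    have h3 := hfd.hasFDerivAt.clm_apply (hasFDerivAt_const b z)
    have h4 := (h1.add h2).congr_of_eventuallyEq (hf' b)
    have h5 := congrArg (fun D => D a) (h3.unique h4)
    simpa [h1', h2'] using h5
  have h1 := key a b
  rw [hsymm, key b a] at h1
  simp only [hm a, hm b] at h1
  simp only [coordCurvature, map_add, map_sub, add_apply, sub_apply]
  linarith

/-- The lifted metric in induced coordinates. -/
def coordLiftMetric (m₁ m₂ m₃ : ℝ) (G : E → E →L[ℝ] E →L[ℝ] ℝ)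
    (Γ : E → E →L[ℝ] E →L[ℝ] E) (q ξ η : E × E) : ℝ :=
  m₁ * G q.1 ξ.1 η.1
    + m₂ * (G q.1 ξ.1 (η.2 + Γ q.1 η.1 q.2) + G q.1 (ξ.2 + Γ q.1 ξ.1 q.2) η.1)
    + m₃ * G q.1 (ξ.2 + Γ q.1 ξ.1 q.2) (η.2 + Γ q.1 η.1 q.2)

lemma hasFDerivAt_comp_fst {W : Type*} [NormedAddCommGroup W] [NormedSpace ℝ W] {f : E → W}
    {z : E} (hf : DifferentiableAt ℝ f z) (v : E) :
    HasFDerivAt (fun q : E × E => f q.1) ((fderiv ℝ f z).comp (ContinuousLinearMap.fst ℝ E E))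
      (z, v) :=
  HasFDerivAt.comp (g := f) (f := Prod.fst) (z, v) hf.hasFDerivAt hasFDerivAt_fst

lemma hasFDerivAt_vertical {Γ : E → E →L[ℝ] E →L[ℝ] E} {z v : E} (hd : DifferentiableAt ℝ Γ z)
    (η : E × E) :
    ∃ D : E × E →L[ℝ] E, HasFDerivAt (fun q : E × E => η.2 + Γ q.1 η.1 q.2) D (z, v) ∧
      ∀ ξ, D ξ = fderiv ℝ Γ z ξ.1 η.1 v + Γ z η.1 ξ.2 := by
  have hΓ := hasFDerivAt_comp_fst (W := E →L[ℝ] E →L[ℝ] E) hd v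
  obtain ⟨D, h, h'⟩ := hasFDerivAt_bilin hΓ (hasFDerivAt_const η.1 (z, v)) hasFDerivAt_snd
  exact ⟨D, h.const_add _, fun ξ => by simpa using h' ξ⟩

/-- The pullback of the base connection preserves the lifted metric. Here `Γ z ξ.1 η.1` and `n η`
are the `dπ`- and `K`-components of the derivative, in the direction `ξ`, of the constant coordinate
field `η`. -/
lemma fderiv_coordLiftMetric {Γ : E → E →L[ℝ] E →L[ℝ] E} {G : E → E →L[ℝ] E →L[ℝ] ℝ} {z v : E}
    (hd : DifferentiableAt ℝ Γ z) (hG : DifferentiableAt ℝ G z) (m₁ m₂ m₃ : ℝ) (ξ η ζ : E × E)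
    (hmet : IsMetricCoord G Γ z) (n : E × E → E)
    (hn : ∀ η, n η = fderiv ℝ Γ z ξ.1 η.1 v + Γ z η.1 ξ.2 + Γ z ξ.1 (η.2 + Γ z η.1 v)) :
    fderiv ℝ (fun q => coordLiftMetric m₁ m₂ m₃ G Γ q η ζ) (z, v) ξ
      = m₁ * (G z (Γ z ξ.1 η.1) ζ.1 + G z η.1 (Γ z ξ.1 ζ.1))
      + m₂ * ((G z (Γ z ξ.1 η.1) (ζ.2 + Γ z ζ.1 v) + G z η.1 (n ζ))
        + (G z (n η) ζ.1 + G z (η.2 + Γ z η.1 v) (Γ z ξ.1 ζ.1)))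
      + m₃ * (G z (n η) (ζ.2 + Γ z ζ.1 v) + G z (η.2 + Γ z η.1 v) (n ζ)) := by
  have hGd := hasFDerivAt_comp_fst (W := E →L[ℝ] E →L[ℝ] ℝ) hG v
  obtain ⟨Kη, hη, hη'⟩ := hasFDerivAt_vertical (v := v) hd η
  obtain ⟨Kζ, hζ, hζ'⟩ := hasFDerivAt_vertical (v := v) hd ζ
  obtain ⟨D1, h1, h1'⟩ := hasFDerivAt_bilin hGd (hasFDerivAt_const η.1 (z, v))
    (hasFDerivAt_const ζ.1 (z, v))
  obtain ⟨D2, h2, h2'⟩ := hasFDerivAt_bilin hGd (hasFDerivAt_const η.1 (z, v)) hζ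
  obtain ⟨D3, h3, h3'⟩ := hasFDerivAt_bilin hGd hη (hasFDerivAt_const ζ.1 (z, v))
  obtain ⟨D4, h4, h4'⟩ := hasFDerivAt_bilin hGd hη hζ
  have h : HasFDerivAt (fun q => coordLiftMetric m₁ m₂ m₃ G Γ q η ζ) _ (z, v) :=
    ((h1.const_mul m₁).add ((h2.add h3).const_mul m₂)).add (h4.const_mul m₃)
  rw [h.fderiv]
  have e := fun a b => hmet ξ.1 a b
  simp only [add_apply, smul_apply, smul_eq_mul, h1', h2', h3', h4', hη', hζ', hn,
    ContinuousLinearMap.comp_apply, ContinuousLinearMap.coe_fst', e, zero_apply, map_zero,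
    map_add]
  ring

/-- The Christoffel symbols of the lifted metric in induced coordinates, in terms of the
horizontal and vertical components. -/
theorem coordLiftMetric_christoffel {Γ : E → E →L[ℝ] E →L[ℝ] E} {G : E → E →L[ℝ] E →L[ℝ] ℝ}
    {z v : E} (hd : DifferentiableAt ℝ Γ z) (hG : ContDiffAt ℝ 2 G z)
    (hs : ∀ᶠ y in 𝓝 z, ∀ a b, Γ y a b = Γ y b a) (hmet : ∀ᶠ y in 𝓝 z, IsMetricCoord G Γ y)
    (hsymm : ∀ a b, G z a b = G z b a) (hnd : ∀ a, (∀ b, G z a b = 0) → a = 0)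
    {m₁ m₂ m₃ : ℝ} (hm : m₁ * m₃ - m₂ ^ 2 ≠ 0) (T : E × E → E × E → E × E)
    (hTs : ∀ ξ η, T ξ η = T η ξ)
    (hT : ∀ ξ η ζ, fderiv ℝ (fun q => coordLiftMetric m₁ m₂ m₃ G Γ q η ζ) (z, v) ξ
      = coordLiftMetric m₁ m₂ m₃ G Γ (z, v) (T ξ η) ζ
        + coordLiftMetric m₁ m₂ m₃ G Γ (z, v) η (T ξ ζ)) (a β c δ : E) :
    let t := T (a, β - Γ z a v) (c, δ - Γ z c v)
    let R := coordCurvature Γ z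
    t.1 = Γ z a c + (m₁ * m₃ - m₂ ^ 2)⁻¹ • ((m₂ * m₃) • R v a c
        + (m₂ * m₃ / 2) • R a c v + (m₃ ^ 2 / 2) • R v δ a + (m₃ ^ 2 / 2) • R v β c) ∧
    t.2 + Γ z t.1 v = fderiv ℝ Γ z a c v - Γ z c (Γ z a v) + Γ z c β + Γ z a δ
      + (m₁ * m₃ - m₂ ^ 2)⁻¹ • (-(m₂ ^ 2) • R v a c
        - (m₁ * m₃ / 2) • R a c v - (m₂ * m₃ / 2) • R v δ a - (m₂ * m₃ / 2) • R v β c) := by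
  intro t R
  have hGd : DifferentiableAt ℝ G z := hG.differentiableAt (by simp)
  -- With `κ` the passage from `(dπ, K)`-components to induced coordinates, `(Γ z p.1 q.1, n p q)`
  -- is the pullback connection applied to the constant coordinate field `κ q` in the direction `κ
  -- p`. Thus `τ` is the difference of the two connections, a tensor.
  set n : E × E → E × E → E := fun p q =>
    fderiv ℝ Γ z p.1 q.1 v - Γ z q.1 (Γ z p.1 v) + Γ z q.1 p.2 + Γ z p.1 q.2 with hn
  set κ : E × E → E × E := fun p => (p.1, p.2 - Γ z p.1 v) with hκ
  set τ : E × E → E × E → E × E := fun p q =>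
    ((T (κ p) (κ q)).1 - Γ z p.1 q.1,
      (T (κ p) (κ q)).2 + Γ z (T (κ p) (κ q)).1 v - n p q) with hτ
  have hsz := hs.self_of_nhds
  have h := contorsion_eq (G z) hsymm hnd R (coordCurvature_anti Γ z)
    (coordCurvature_bianchi hd hs) (fun a b c d => by
      have h1 := coordCurvature_skew hd hG hmet a b c d
      rw [hsymm c] at h1
      linarith) hm v τ
    (fun ξ η => m₁ * G z ξ.1 η.1 + m₂ * (G z ξ.1 η.2 + G z ξ.2 η.1) + m₃ * G z ξ.2 η.2)
    (fun _ _ => rfl) ?_ ?_ a β c δ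
  · obtain ⟨h1, h2⟩ := h
    rw [← h1, ← h2]
    simp only [hτ, hn, hκ, t]
    constructor <;> abel
  · intro ξ η ζ
    have h1 := hT (κ ξ) (κ η) (κ ζ)
    rw [fderiv_coordLiftMetric hd hGd m₁ m₂ m₃ (κ ξ) (κ η) (κ ζ) hmet.self_of_nhds
      (fun q => n ξ (q.1, q.2 + Γ z q.1 v)) (fun q => by simp only [hn, hκ, map_sub, map_add]; abel)]
      at h1
    simp only [coordLiftMetric, hκ, sub_add_cancel] at h1
    simp only [hτ, hκ, map_sub, sub_apply]
    linear_combination -h1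
  -- `T` is symmetric, so only the antisymmetrization of `n` survives, and this is the curvature.
  · intro ξ η
    simp only [hτ, hn, hTs (κ η) (κ ξ), R, coordCurvature, hsz η.1 ξ.1]
    ext
    · simp
    · simp only [Prod.snd_sub, Prod.snd_neg]
      abel

end CoordinateCalculus

/-! ### Smoothness of the Christoffel symbols. -/

section CoordinateCalculus

set_option synthInstance.maxHeartbeats 200000

variable {E : Type*} [NormedAddCommGroup E] [NormedSpace ℝ E]

lemma isMetricCoord_iff {G : E → E →L[ℝ] E →L[ℝ] ℝ} {Γ : E → E →L[ℝ] E →L[ℝ] E} {z : E}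
    (hG : DifferentiableAt ℝ G z) :
    IsMetricCoord G Γ z ↔ ∀ a b c,
      fderiv ℝ (fun y => G y b c) z a = G z (Γ z a b) c + G z b (Γ z a c) := by
  have h : ∀ a b c, fderiv ℝ (fun y => G y b c) z a = fderiv ℝ G z a b c := by
    intro a b c
    obtain ⟨D, hD, hD'⟩ := hasFDerivAt_bilin hG.hasFDerivAt
      (hasFDerivAt_const b z) (hasFDerivAt_const c z)
    rw [hD.fderiv, hD']
    simp
  simp only [IsMetricCoord, h]

/-- The Christoffel symbols of a smooth metric are smooth (Koszul formula). -/
lemma contDiffOn_christoffel [FiniteDimensional ℝ E] {G : E → E →L[ℝ] E →L[ℝ] ℝ}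
    {Γ : E → E →L[ℝ] E →L[ℝ] E} {s : Set E} (hs : IsOpen s) (hG : ContDiffOn ℝ ∞ G s)
    (hGs : ∀ z ∈ s, ∀ a b, G z a b = G z b a) (hnd : ∀ z ∈ s, ∀ a, (∀ b, G z a b = 0) → a = 0)
    (hΓ : ∀ z ∈ s, ∀ a b, Γ z a b = Γ z b a) (hmet : ∀ z ∈ s, IsMetricCoord G Γ z) :
    ContDiffOn ℝ ∞ Γ s := by
  have hGd : ∀ z ∈ s, DifferentiableAt ℝ G z := fun z hz =>
    (hG.contDiffAt (hs.mem_nhds hz)).differentiableAt (by simp)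
  have hGbc : ∀ a b c, ContDiffOn ℝ ∞ (fun z => fderiv ℝ (fun y => G y b c) z a) s := by
    intro a b c
    have h1 : ContDiffOn ℝ ∞ (fun y => G y b c) s :=
      (hG.clm_apply contDiffOn_const).clm_apply contDiffOn_const
    exact (h1.fderiv_of_isOpen hs (m := ∞) (by simp)).clm_apply contDiffOn_const
  have hinv : ∀ z ∈ s, ∃ e : E ≃L[ℝ] (E →L[ℝ] ℝ), (e : E →L[ℝ] E →L[ℝ] ℝ) = G z := by
    intro z hz
    have hinj : Function.Injective (G z) := by
      rw [injective_iff_map_eq_zero]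
      exact fun a ha => hnd z hz a fun b => by rw [ha]; rfl
    have hdim : Module.finrank ℝ E = Module.finrank ℝ (E →L[ℝ] ℝ) := by
      rw [← (LinearMap.toContinuousLinearMap (𝕜 := ℝ) (E := E) (F' := ℝ)).finrank_eq]
      exact (Subspace.dual_finrank_eq (K := ℝ) (V := E)).symm
    refine ⟨(LinearEquiv.ofInjectiveOfFinrankEq (G z : E →ₗ[ℝ] E →L[ℝ] ℝ) hinj
      hdim).toContinuousLinearEquiv, ?_⟩
    ext
    rfl
  refine contDiffOn_clm_apply.2 fun a => contDiffOn_clm_apply.2 fun b => ?_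
  -- Koszul: `G (Γ a b) c` is half of `∂_a G(b, c) + ∂_b G(a, c) - ∂_c G(a, b)`. No regularity of
  -- `Γ` is presupposed; it is recovered by applying the smooth inverse of `G`.
  have hΦ : ContDiffOn ℝ ∞ (fun z => G z (Γ z a b)) s := by
    refine contDiffOn_clm_apply.2 fun c => ?_
    refine ((((hGbc a b c).add (hGbc b a c)).sub (hGbc c a b)).const_smul (1 / 2 : ℝ)).congr
      fun z hz => ?_
    have h := (isMetricCoord_iff (hGd z hz)).1 (hmet z hz)
    simp only [h, smul_eq_mul, hΓ z hz b a, hΓ z hz c a, hΓ z hz c b,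
      hGs z hz b (Γ z a c)]
    ring
  intro z hz
  obtain ⟨e, he⟩ := hinv z hz
  have h1 : ContDiffAt ℝ ∞ (fun y => ContinuousLinearMap.inverse (G y)) z := by
    have h2 := contDiffAt_map_inverse (𝕜 := ℝ) (n := ∞) e
    rw [he] at h2
    exact h2.comp z (hG.contDiffAt (hs.mem_nhds hz))
  refine ((h1.contDiffWithinAt (s := s)).clm_apply (hΦ z hz)).congr (fun y hy => ?_) ?_
  · obtain ⟨e', he'⟩ := hinv y hy
    rw [← he', ContinuousLinearMap.inverse_equiv]
    simp
  · rw [← he, ContinuousLinearMap.inverse_equiv]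
    simp

end CoordinateCalculus

/-! ### Components of vector fields and the flat connection of a chart. -/

section Charts

set_option linter.unusedSectionVars false

variable {F : Type*} [NormedAddCommGroup F] [NormedSpace ℝ F]
  {H : Type*} [TopologicalSpace H] {I : ModelWithCorners ℝ F H}
  {N : Type*} [TopologicalSpace N] [ChartedSpace H N]
  {F' : Type*} [NormedAddCommGroup F'] [NormedSpace ℝ F']

variable (I) in
/-- The derivative of a function with values in a vector space. -/
def coordD (f : N → F') (y : N) : TangentSpace I y →L[ℝ] F' := mfderiv I 𝓘(ℝ, F') f y

lemma coordD_add {f g : N → F'} {y : N} (hf : MDifferentiableAt I 𝓘(ℝ, F') f y)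
    (hg : MDifferentiableAt I 𝓘(ℝ, F') g y) :
    coordD I (fun x => f x + g x) y = coordD I f y + coordD I g y :=
  (hf.hasMFDerivAt.add hg.hasMFDerivAt).mfderiv

lemma coordD_smul {a : N → ℝ} {f : N → F'} {y : N} (ha : MDifferentiableAt I 𝓘(ℝ, ℝ) a y)
    (hf : MDifferentiableAt I 𝓘(ℝ, F') f y) :
    coordD I (fun x => a x • f x) y = a y • coordD I f y + (coordD I a y).smulRight (f y) := by
  change mvfderiv I (a • f) y = a y • mvfderiv I f y + (mvfderiv I a y).smulRight (f y)
  exact mvfderiv_smul ha hf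

lemma ContMDiffAt.coordD_apply [IsManifold I 1 N] {m n : ℕ∞ω} {f : N → F'} {y : N}
    {σ : ∀ x : N, TangentSpace I x} (hf : CMDiffAt n f y) (hσ : CMDiffAt m (T% σ) y)
    (hmn : m + 1 ≤ n) :
    ContMDiffAt I 𝓘(ℝ, F') m (fun x => coordD I f x (σ x)) y := by
  have h1 := hf.mfderiv_const hmn
  have h2 : ContMDiffAt I 𝓘(ℝ, F').tangent m
      (fun x => (⟨f x, mfderiv I 𝓘(ℝ, F') f x (σ x)⟩ : TangentBundle 𝓘(ℝ, F') F')) y :=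
    ContMDiffAt.clm_apply_of_inCoordinates h1 hσ (hf.of_le (le_self_add.trans hmn))
  exact (contMDiff_snd_tangentBundle_modelSpace F' 𝓘(ℝ, F')).contMDiffAt.comp y h2

lemma MDifferentiableAt.coordD_apply [IsManifold I 1 N] {f : N → F'} {y : N}
    {σ : ∀ x : N, TangentSpace I x} (hf : CMDiffAt 2 f y) (hσ : MDiffAt (T% σ) y) :
    MDifferentiableAt I 𝓘(ℝ, F') (fun x => coordD I f x (σ x)) y := by
  have h1 := (hf.mfderiv_const (m := 1) (by norm_num)).mdifferentiableAt (by simp)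
  have h2 : MDifferentiableAt I 𝓘(ℝ, F').tangent
      (fun x => (⟨f x, mfderiv I 𝓘(ℝ, F') f x (σ x)⟩ : TangentBundle 𝓘(ℝ, F') F')) y :=
    MDifferentiableAt.clm_apply_of_inCoordinates h1 hσ (hf.mdifferentiableAt (by simp))
  exact ((contMDiff_snd_tangentBundle_modelSpace (n := 1) F' 𝓘(ℝ, F')).mdifferentiable
    (by simp)).mdifferentiableAt.comp y h2

/-- The flat connection of the coordinates given by a map `f` into a vector space. -/
def flatCov (f : N → F') (σ : ∀ x : N, TangentSpace I x) (y : N) :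
    TangentSpace I y →L[ℝ] TangentSpace I y :=
  (coordD I f y).inverse ∘L coordD I (fun x => coordD I f x (σ x)) y

lemma isCovariantDerivativeOn_flatCov [IsManifold I 1 N] {f : N → F'} {s : Set N}
    (hf : ∀ y ∈ s, CMDiffAt 2 f y) (hinv : ∀ y ∈ s, (coordD I f y).IsInvertible) :
    IsCovariantDerivativeOn F (flatCov (I := I) f) s where
  add {σ σ' y} hσ hσ' hy := by
    have h1 := MDifferentiableAt.coordD_apply (hf y hy) hσ
    have h2 := MDifferentiableAt.coordD_apply (hf y hy) hσ'
    simp only [flatCov, Pi.add_apply, map_add, coordD_add h1 h2, ContinuousLinearMap.comp_add]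
  leibniz {σ g y} hσ hg hy := by
    have h1 := MDifferentiableAt.coordD_apply (hf y hy) hσ
    ext w
    simp only [flatCov, Pi.smul_apply', map_smul, coordD_smul hg h1]
    simp only [ContinuousLinearMap.comp_apply, add_apply, smul_apply,
      ContinuousLinearMap.smulRight_apply, map_add, map_smul, (hinv y hy).inverse_apply_self]
    rfl

section ExtChart

variable [IsManifold I ∞ N] (x₀ : N) {y : N}

lemma contMDiffAt_extChartAt_infty (hy : y ∈ (chartAt H x₀).source) :
    CMDiffAt ∞ (extChartAt I x₀) y := contMDiffAt_extChartAt' hy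

lemma isInvertible_coordD (hy : y ∈ (chartAt H x₀).source) :
    (coordD I (extChartAt I x₀) y).IsInvertible :=
  isInvertible_mfderiv_extChartAt (by rwa [extChartAt_source])

lemma isCovariantDerivativeOn_flatCov_extChartAt :
    IsCovariantDerivativeOn F (flatCov (I := I) (extChartAt I x₀)) (chartAt H x₀).source :=
  isCovariantDerivativeOn_flatCov
    (fun _ hy => (contMDiffAt_extChartAt_infty x₀ hy).of_le (by norm_cast))
    (fun _ hy => isInvertible_coordD x₀ hy)

variable {x₀}

/-- The components of the vector field `σ` in the chart at `x₀`, as a function on the model. -/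
def localRep (x₀ : N) (σ : ∀ x : N, TangentSpace I x) (z : F) : F :=
  coordD I (extChartAt I x₀) ((extChartAt I x₀).symm z) (σ ((extChartAt I x₀).symm z))

/-- The vector field with constant components `w` in the chart at `x₀`. -/
def frame (I : ModelWithCorners ℝ F H) (x₀ : N) (w : F) (x : N) : TangentSpace I x :=
  (coordD I (extChartAt I x₀) x).inverse w

variable [I.Boundaryless]

lemma contMDiffAt_extChartAt_symm (hy : y ∈ (chartAt H x₀).source) :
    ContMDiffAt 𝓘(ℝ, F) I ∞ (extChartAt I x₀).symm (extChartAt I x₀ y) := by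
  refine (contMDiffOn_extChartAt_symm x₀).contMDiffAt ?_
  exact extChartAt_target_mem_nhds' ((extChartAt I x₀).map_source (by rwa [extChartAt_source]))

lemma extChartAt_symm_apply (hy : y ∈ (chartAt H x₀).source) :
    (extChartAt I x₀).symm (extChartAt I x₀ y) = y :=
  (extChartAt I x₀).left_inv (by rwa [extChartAt_source])

lemma localRep_apply (σ : ∀ x : N, TangentSpace I x) (hy : y ∈ (chartAt H x₀).source) :
    localRep x₀ σ (extChartAt I x₀ y) = coordD I (extChartAt I x₀) y (σ y) := by
  rw [localRep, extChartAt_symm_apply hy]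

lemma coordD_eq_fderiv_comp {f : N → F'} (hy : y ∈ (chartAt H x₀).source)
    (hf : MDifferentiableAt I 𝓘(ℝ, F') f y) (w : TangentSpace I y) :
    coordD I f y w = fderiv ℝ (f ∘ (extChartAt I x₀).symm) (extChartAt I x₀ y)
      (coordD I (extChartAt I x₀) y w) := by
  have h1 : DifferentiableAt ℝ (f ∘ (extChartAt I x₀).symm) (extChartAt I x₀ y) := by
    rw [← mdifferentiableAt_iff_differentiableAt]
    refine MDifferentiableAt.comp _ ?_
      ((contMDiffAt_extChartAt_symm hy).mdifferentiableAt (by simp))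
    rwa [extChartAt_symm_apply hy]
  have h2 : (f ∘ (extChartAt I x₀).symm) ∘ extChartAt I x₀ =ᶠ[𝓝 y] f := by
    filter_upwards [(chartAt H x₀).open_source.mem_nhds hy] with x hx
    simp only [Function.comp_apply, extChartAt_symm_apply hx]
  have h3 := (h1.hasFDerivAt.hasMFDerivAt.comp y
    ((contMDiffAt_extChartAt_infty x₀ hy).mdifferentiableAt (by simp)).hasMFDerivAt)
  have h4 := (h3.congr_of_eventuallyEq h2.symm).mfderiv
  exact congrArg (fun D => D w) h4

lemma contMDiffAt_comp_symm {n : ℕ∞ω} {f : N → F'} (hn : n ≤ ∞) (hy : y ∈ (chartAt H x₀).source)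
    (hf : ContMDiffAt I 𝓘(ℝ, F') n f y) :
    ContDiffAt ℝ n (f ∘ (extChartAt I x₀).symm) (extChartAt I x₀ y) := by
  rw [← contMDiffAt_iff_contDiffAt]
  refine ContMDiffAt.comp _ ?_ ((contMDiffAt_extChartAt_symm hy).of_le hn)
  rwa [extChartAt_symm_apply hy]

lemma contDiffAt_localRep {σ : ∀ x : N, TangentSpace I x} (hy : y ∈ (chartAt H x₀).source)
    (hσ : CMDiffAt ∞ (T% σ) y) : ContDiffAt ℝ ∞ (localRep x₀ σ) (extChartAt I x₀ y) :=
  contMDiffAt_comp_symm le_rfl hy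
    (ContMDiffAt.coordD_apply (contMDiffAt_extChartAt_infty x₀ hy) hσ (by simp))

/-- The field is the pullback of its components under the chart, and pullback by a smooth map with
invertible derivative preserves smoothness. -/
lemma contMDiffAt_of_localRep [CompleteSpace F] {σ : ∀ x : N, TangentSpace I x}
    (hy : y ∈ (chartAt H x₀).source)
    (hσ : ContDiffAt ℝ ∞ (localRep x₀ σ) (extChartAt I x₀ y)) : CMDiffAt ∞ (T% σ) y := by
  let V : ∀ z : F, TangentSpace 𝓘(ℝ, F) z := localRep x₀ σ
  have hV : ContMDiffAt 𝓘(ℝ, F) 𝓘(ℝ, F).tangent ∞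
      (fun z => (⟨z, V z⟩ : TangentBundle 𝓘(ℝ, F) F)) (extChartAt I x₀ y) :=
    contMDiffAt_vectorSpace_iff_contDiffAt.2 hσ
  have h1 := ContMDiffAt.mpullback_vectorField_preimage hV (contMDiffAt_extChartAt_infty x₀ hy)
    (isInvertible_mfderiv_extChartAt (by rwa [extChartAt_source])) (by simp)
  refine h1.congr_of_eventuallyEq ?_
  filter_upwards [(chartAt H x₀).open_source.mem_nhds hy] with x hx
  have h2 : VectorField.mpullback I 𝓘(ℝ, F) (extChartAt I x₀) V x = σ x := by
    refine Eq.trans ?_ ((isInvertible_coordD x₀ hx).inverse_apply_self (σ x))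
    exact congrArg (coordD I (extChartAt I x₀) x).inverse (localRep_apply σ hx)
  rw [h2]

lemma coordD_frame (w : F) (hy : y ∈ (chartAt H x₀).source) :
    coordD I (extChartAt I x₀) y (frame I x₀ w y) = w :=
  (isInvertible_coordD x₀ hy).self_apply_inverse w

lemma frame_coordD (hy : y ∈ (chartAt H x₀).source) (w : TangentSpace I y) :
    frame I x₀ (coordD I (extChartAt I x₀) y w) y = w :=
  (isInvertible_coordD x₀ hy).inverse_apply_self w

lemma localRep_frame (w : F) (hy : y ∈ (chartAt H x₀).source) :
    localRep x₀ (frame I x₀ w) =ᶠ[𝓝 (extChartAt I x₀ y)] fun _ => w := by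
  have h : extChartAt I x₀ y ∈ (extChartAt I x₀).target :=
    (extChartAt I x₀).map_source (by rwa [extChartAt_source])
  filter_upwards [extChartAt_target_mem_nhds' h] with z hz
  refine coordD_frame w ?_
  rw [← extChartAt_source I]
  exact (extChartAt I x₀).map_target hz

lemma contMDiffAt_frame [CompleteSpace F] (w : F) (hy : y ∈ (chartAt H x₀).source) :
    CMDiffAt ∞ (T% (frame I x₀ w)) y :=
  contMDiffAt_of_localRep hy (contDiffAt_const.congr_of_eventuallyEq (localRep_frame w hy))

/-- Frame fields are pullbacks of constant fields, whose bracket vanishes, and the bracket is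
natural under pullback. -/
lemma mlieBracket_frame [CompleteSpace F] (v w : F) (hy : y ∈ (chartAt H x₀).source) :
    VectorField.mlieBracket I (frame I x₀ v) (frame I x₀ w) y = 0 := by
  have hc : ∀ w : F, MDifferentiableAt 𝓘(ℝ, F) 𝓘(ℝ, F).tangent
      (fun z : F => (⟨z, w⟩ : TangentBundle 𝓘(ℝ, F) F)) (extChartAt I x₀ y) := fun w =>
    ((contMDiffAt_vectorSpace_iff_contDiffAt (n := 1)).2
      (contDiffAt_const (c := w))).mdifferentiableAt (by simp)
  have : IsManifold I (minSmoothness ℝ 2) N := by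
    rw [minSmoothness_of_isRCLikeNormedField]
    infer_instance
  let V : ∀ z : F, TangentSpace 𝓘(ℝ, F) z := fun _ => v
  let W : ∀ z : F, TangentSpace 𝓘(ℝ, F) z := fun _ => w
  have h1 := VectorField.mpullback_mlieBracket (V := V) (W := W) (hc v) (hc w)
    (contMDiffAt_extChartAt_infty (I := I) x₀ hy)
    (by rw [minSmoothness_of_isRCLikeNormedField]; norm_cast)
  have h2 : VectorField.mpullback I 𝓘(ℝ, F) (extChartAt I x₀)
      (VectorField.mlieBracket 𝓘(ℝ, F) V W) y = 0 := by
    rw [VectorField.mpullback_apply, ← VectorField.mlieBracketWithin_univ,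
      VectorField.mlieBracketWithin_eq_lieBracketWithin, VectorField.lieBracketWithin_univ]
    have h3 : VectorField.lieBracket ℝ V W (extChartAt I x₀ y) = 0 := by
      simp [VectorField.lieBracket, V, W]
    rw [h3]
    exact map_zero (mfderiv I 𝓘(ℝ, F) (extChartAt I x₀) y).inverse
  exact h1.symm.trans h2

end ExtChart

end Charts

/-! ### Christoffel symbols of a connection on a manifold. -/

section Christoffel

set_option linter.unusedSectionVars false

variable {F : Type*} [NormedAddCommGroup F] [NormedSpace ℝ F] [FiniteDimensional ℝ F]
  {H : Type*} [TopologicalSpace H] {I : ModelWithCorners ℝ F H} [I.Boundaryless]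
  {N : Type*} [TopologicalSpace N] [ChartedSpace H N] [IsManifold I ∞ N]

/-- The Christoffel symbols of `cov` in the chart at `x₀`, at a point of the manifold. -/
def christoffelAt (cov : CovariantDerivative I F (TangentSpace I : N → Type _)) (x₀ y : N) :
    F →L[ℝ] F →L[ℝ] F :=
  let D := cov.isCovariantDerivativeOn.difference (isCovariantDerivativeOn_flatCov_extChartAt x₀) y
  let Φ := coordD I (extChartAt I x₀) y
  LinearMap.toContinuousLinearMap
    ((LinearMap.toContinuousLinearMap (𝕜 := ℝ) (E := F) (F' := F)).toLinearMap ∘ₗ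
      -- The difference tensor takes the differentiated vector before the direction; in `Γ a b` the
      -- direction is `a`, hence the exchange.
      LinearMap.mk₂ ℝ (fun a b => Φ (D (Φ.inverse b) (Φ.inverse a)))
        (fun _ _ _ => by simp only [map_add]) (fun _ _ _ => by simp only [map_smul])
        (fun _ _ _ => by simp only [map_add, add_apply])
        (fun _ _ _ => by simp only [map_smul, smul_apply]))

lemma christoffelAt_apply (cov : CovariantDerivative I F (TangentSpace I : N → Type _))
    (x₀ y : N) (a b : F) :
    christoffelAt cov x₀ y a b = coordD I (extChartAt I x₀) y
      (cov.isCovariantDerivativeOn.difference (isCovariantDerivativeOn_flatCov_extChartAt x₀) y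
        ((coordD I (extChartAt I x₀) y).inverse b) ((coordD I (extChartAt I x₀) y).inverse a)) :=
  rfl

/-- The Christoffel symbols of `cov` in the chart at `x₀`, as functions of the coordinates. -/
def christoffel (cov : CovariantDerivative I F (TangentSpace I : N → Type _)) (x₀ : N) (z : F) :
    F →L[ℝ] F →L[ℝ] F :=
  christoffelAt cov x₀ ((extChartAt I x₀).symm z)

variable {x₀ : N} {y : N} (cov : CovariantDerivative I F (TangentSpace I : N → Type _))

/-- The covariant derivative in a chart. -/
lemma coordD_cov (hy : y ∈ (chartAt H x₀).source) {σ : ∀ x : N, TangentSpace I x}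
    (hσ : MDiffAt (T% σ) y) (w : TangentSpace I y) :
    coordD I (extChartAt I x₀) y (cov σ y w)
      = fderiv ℝ (localRep x₀ σ) (extChartAt I x₀ y) (coordD I (extChartAt I x₀) y w)
        + christoffel cov x₀ (extChartAt I x₀ y) (coordD I (extChartAt I x₀) y w)
          (coordD I (extChartAt I x₀) y (σ y)) := by
  have hinv := isInvertible_coordD (I := I) x₀ hy
  have h1 := IsCovariantDerivativeOn.difference_apply cov.isCovariantDerivativeOn
    (isCovariantDerivativeOn_flatCov_extChartAt x₀) hy hσ
  have hd : MDifferentiableAt I 𝓘(ℝ, F) (fun x => coordD I (extChartAt I x₀) x (σ x)) y :=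
    MDifferentiableAt.coordD_apply
      ((contMDiffAt_extChartAt_infty x₀ hy).of_le (by norm_cast)) hσ
  have h2 := coordD_eq_fderiv_comp hy hd w
  have h3 : christoffel cov x₀ (extChartAt I x₀ y) (coordD I (extChartAt I x₀) y w)
      (coordD I (extChartAt I x₀) y (σ y)) = coordD I (extChartAt I x₀) y
        (cov σ y w - flatCov (extChartAt I x₀) σ y w) := by
    have h4 := congrArg (fun D => coordD I (extChartAt I x₀) y (D w)) h1
    refine Eq.trans ?_ h4
    rw [christoffel, extChartAt_symm_apply hy]
    rw [christoffelAt_apply, hinv.inverse_apply_self, hinv.inverse_apply_self]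
  rw [h3, map_sub]
  have h5 : coordD I (extChartAt I x₀) y (flatCov (extChartAt I x₀) σ y w)
      = coordD I (fun x => coordD I (extChartAt I x₀) x (σ x)) y w :=
    hinv.self_apply_inverse _
  rw [h5, h2]
  change _ = fderiv ℝ (localRep x₀ σ) _ _ + (_ - fderiv ℝ (localRep x₀ σ) _ _)
  abel

lemma coordD_cov_frame (hy : y ∈ (chartAt H x₀).source) (a b : F) :
    coordD I (extChartAt I x₀) y (cov (frame I x₀ b) y (frame I x₀ a y))
      = christoffel cov x₀ (extChartAt I x₀ y) a b := by
  rw [coordD_cov cov hy ((contMDiffAt_frame b hy).mdifferentiableAt (by simp)),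
    coordD_frame _ hy, coordD_frame _ hy, (localRep_frame b hy).fderiv_eq]
  simp

variable {cov} {g : ∀ x : N, TangentSpace I x → TangentSpace I x → ℝ}

lemma christoffel_symm (hcov : IsLeviCivita g cov) (hy : y ∈ (chartAt H x₀).source) (a b : F) :
    christoffel cov x₀ (extChartAt I x₀ y) a b = christoffel cov x₀ (extChartAt I x₀ y) b a := by
  have h := hcov.torsion_free ((contMDiffAt_frame (I := I) a hy).mdifferentiableAt (by simp))
    ((contMDiffAt_frame b hy).mdifferentiableAt (by simp))
  rw [mlieBracket_frame a b hy, sub_eq_zero] at h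
  rw [← coordD_cov_frame cov hy, ← coordD_cov_frame cov hy, h]

/-- The form `g` is arbitrary, so that this applies both to the metric of `M` and to the lifted
metric on `TM`; its differentiability on frame fields is therefore a hypothesis. -/
lemma christoffel_compatible (hcov : IsLeviCivita g cov) (hy : y ∈ (chartAt H x₀).source)
    (b c : F) (hg : MDifferentiableAt I 𝓘(ℝ, ℝ) (fun x => g x (frame I x₀ b x) (frame I x₀ c x)) y)
    (a : F) :
    fderiv ℝ (fun z => g ((extChartAt I x₀).symm z) (frame I x₀ b ((extChartAt I x₀).symm z))
        (frame I x₀ c ((extChartAt I x₀).symm z))) (extChartAt I x₀ y) a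
      = g y (frame I x₀ (christoffel cov x₀ (extChartAt I x₀ y) a b) y) (frame I x₀ c y)
        + g y (frame I x₀ b y) (frame I x₀ (christoffel cov x₀ (extChartAt I x₀ y) a c) y) := by
  have h := hcov.compatible ((contMDiffAt_frame b hy).mdifferentiableAt (by simp))
    ((contMDiffAt_frame c hy).mdifferentiableAt (by simp)) (frame I x₀ a y)
  have h2 := coordD_eq_fderiv_comp hy hg (frame I x₀ a y)
  rw [coordD_frame _ hy] at h2
  refine Eq.trans h2.symm (Eq.trans h ?_)
  rw [← coordD_cov_frame cov hy, ← coordD_cov_frame cov hy, frame_coordD hy, frame_coordD hy]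

end Christoffel

/-! ### The Riemannian metric of the base in a chart. -/

section BaseCoordinates

set_option linter.unusedSectionVars false

variable {E : Type*} [NormedAddCommGroup E] [NormedSpace ℝ E] [FiniteDimensional ℝ E]
  {H : Type*} [TopologicalSpace H] {I : ModelWithCorners ℝ E H} [I.Boundaryless]
  {M : Type*} [TopologicalSpace M] [ChartedSpace H M] [IsManifold I ∞ M]

lemma mem_chart_source_of_mem_target {x₀ : M} {z : E} (hz : z ∈ (extChartAt I x₀).target) :
    (extChartAt I x₀).symm z ∈ (chartAt H x₀).source := by
  rw [← extChartAt_source I]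
  exact (extChartAt I x₀).map_target hz

lemma mem_target_of_mem_chart_source {x₀ y : M} (hy : y ∈ (chartAt H x₀).source) :
    extChartAt I x₀ y ∈ (extChartAt I x₀).target :=
  (extChartAt I x₀).map_source (by rwa [extChartAt_source])

/-- The components of a metric in the chart at `x₀`. -/
def metricRep (g : ∀ x : M, TangentSpace I x →L[ℝ] TangentSpace I x →L[ℝ] ℝ) (x₀ : M) (z : E) :
    E →L[ℝ] E →L[ℝ] ℝ :=
  let y := (extChartAt I x₀).symm z
  LinearMap.toContinuousLinearMap
    ((LinearMap.toContinuousLinearMap (𝕜 := ℝ) (E := E) (F' := ℝ)).toLinearMap ∘ₗ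
      LinearMap.mk₂ ℝ (fun a b => g y (frame I x₀ a y) (frame I x₀ b y))
        (fun _ _ _ => by simp only [frame, map_add, add_apply])
        (fun _ _ _ => by simp only [frame, map_smul, smul_apply])
        (fun _ _ _ => by simp only [frame, map_add])
        (fun _ _ _ => by simp only [frame, map_smul]))

lemma metricRep_apply (g : ∀ x : M, TangentSpace I x →L[ℝ] TangentSpace I x →L[ℝ] ℝ) (x₀ : M)
    (z a b : E) : metricRep g x₀ z a b = g ((extChartAt I x₀).symm z)
      (frame I x₀ a ((extChartAt I x₀).symm z)) (frame I x₀ b ((extChartAt I x₀).symm z)) := rfl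

lemma metricRep_coordD (g : ∀ x : M, TangentSpace I x →L[ℝ] TangentSpace I x →L[ℝ] ℝ)
    {x₀ y : M} (hy : y ∈ (chartAt H x₀).source) (v w : TangentSpace I y) :
    metricRep g x₀ (extChartAt I x₀ y) (coordD I (extChartAt I x₀) y v)
      (coordD I (extChartAt I x₀) y w) = g y v w := by
  rw [metricRep_apply, extChartAt_symm_apply hy, frame_coordD hy, frame_coordD hy]

variable (g : ContMDiffRiemannianMetric I ∞ E (TangentSpace I : M → Type _)) (x₀ : M)

lemma contMDiffAt_inner_frame {y : M} (hy : y ∈ (chartAt H x₀).source) (a b : E) :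
    ContMDiffAt I 𝓘(ℝ, ℝ) ∞ (fun x => g.inner x (frame I x₀ a x) (frame I x₀ b x)) y := by
  have h : ContMDiffAt I (I.prod 𝓘(ℝ, ℝ)) ∞ (fun x => TotalSpace.mk' ℝ (E := Bundle.Trivial M ℝ) x
      (g.inner x (frame I x₀ a x) (frame I x₀ b x))) y :=
    ContMDiffAt.clm_bundle_apply₂ (F₁ := E) (F₂ := E) g.contMDiff.contMDiffAt
      (contMDiffAt_frame a hy) (contMDiffAt_frame b hy)
  simp only [contMDiffAt_totalSpace] at h
  exact h.2

lemma contDiffOn_metricRep :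
    ContDiffOn ℝ ∞ (metricRep g.inner x₀) (extChartAt I x₀).target := by
  refine contDiffOn_clm_apply.2 fun a => contDiffOn_clm_apply.2 fun b => fun z hz => ?_
  have hy := mem_chart_source_of_mem_target hz
  have h := contMDiffAt_comp_symm le_rfl hy (contMDiffAt_inner_frame g x₀ hy a b)
  rw [(extChartAt I x₀).right_inv hz] at h
  exact h.contDiffWithinAt

lemma metricRep_symm (z a b : E) :
    metricRep g.inner x₀ z a b = metricRep g.inner x₀ z b a := by
  simp only [metricRep_apply, g.symm]

lemma metricRep_nondegenerate {z : E} (hz : z ∈ (extChartAt I x₀).target) (a : E)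
    (h : ∀ b, metricRep g.inner x₀ z a b = 0) : a = 0 := by
  have hy := mem_chart_source_of_mem_target hz
  by_contra ha
  have hne : frame I x₀ a ((extChartAt I x₀).symm z) ≠ 0 := by
    intro h0
    apply ha
    rw [← coordD_frame (I := I) a hy, h0, map_zero]
  exact (g.pos _ _ hne).ne' (h a)

variable {g} {cov : CovariantDerivative I E (TangentSpace I : M → Type _)}
  (hcov : IsLeviCivita (fun x v w => g.inner x v w) cov)

include hcov

lemma isMetricCoord_metricRep {z : E} (hz : z ∈ (extChartAt I x₀).target) :
    IsMetricCoord (metricRep g.inner x₀) (christoffel cov x₀) z := by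
  have hy := mem_chart_source_of_mem_target hz
  have hd : DifferentiableAt ℝ (metricRep g.inner x₀) z :=
    ((contDiffOn_metricRep g x₀).contDiffAt
      ((isOpen_extChartAt_target x₀).mem_nhds hz)).differentiableAt (by simp)
  rw [isMetricCoord_iff hd]
  intro a b c
  have h := christoffel_compatible hcov hy b c
    ((contMDiffAt_inner_frame g x₀ hy b c).mdifferentiableAt (by simp)) a
  rw [(extChartAt I x₀).right_inv hz] at h
  exact h

lemma christoffel_symm_of_mem_target {z : E} (hz : z ∈ (extChartAt I x₀).target) (a b : E) :
    christoffel cov x₀ z a b = christoffel cov x₀ z b a := by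
  have h := christoffel_symm hcov (mem_chart_source_of_mem_target hz) a b
  rwa [(extChartAt I x₀).right_inv hz] at h

lemma contDiffOn_christoffel_metricRep :
    ContDiffOn ℝ ∞ (christoffel cov x₀) (extChartAt I x₀).target :=
  contDiffOn_christoffel (isOpen_extChartAt_target x₀) (contDiffOn_metricRep g x₀)
    (fun z _ => metricRep_symm g x₀ z) (fun _ hz => metricRep_nondegenerate g x₀ hz)
    (fun _ hz => christoffel_symm_of_mem_target x₀ hcov hz)
    (fun _ hz => isMetricCoord_metricRep x₀ hcov hz)

end BaseCoordinates

/-! ### The curvature tensor in a chart. -/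

section CurvatureCoordinates

set_option linter.unusedSectionVars false

variable {E : Type*} [NormedAddCommGroup E] [NormedSpace ℝ E] [FiniteDimensional ℝ E]
  {H : Type*} [TopologicalSpace H] {I : ModelWithCorners ℝ E H} [I.Boundaryless]
  {M : Type*} [TopologicalSpace M] [ChartedSpace H M] [IsManifold I ∞ M]

lemma trivializationAt_apply_eq_coordD {p x : M} (hx : x ∈ (chartAt H p).source)
    (w : TangentSpace I x) :
    (trivializationAt E (TangentSpace I : M → Type _) p ⟨x, w⟩).2
      = coordD I (extChartAt I p) x w := by
  have h := TangentBundle.continuousLinearMapAt_trivializationAt (I := I) hx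
  have h2 := congrArg (fun D => D w) h
  refine Eq.trans ?_ h2
  exact ((trivializationAt E (TangentSpace I : M → Type _) p).continuousLinearMapAt_apply_of_mem
    ℝ hx w).symm

/-- The trivialization of `TM` at `p` is the derivative of the chart, so extensions constant in it
are coordinate frame fields. This makes `curvature` and `connectionMap` computable in coordinates.
-/
lemma extend_eq_frame {p x : M} (hx : x ∈ (chartAt H p).source) (a : TangentSpace I p) :
    FiberBundle.extend E a x = frame I p (coordD I (extChartAt I p) p a) x := by
  have h1 : coordD I (extChartAt I p) x (FiberBundle.extend E a x)
      = coordD I (extChartAt I p) p a := by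
    rw [← trivializationAt_apply_eq_coordD hx,
      ← trivializationAt_apply_eq_coordD (mem_chart_source H p)]
    have h := (trivializationAt E (TangentSpace I : M → Type _) p).apply_mk_symm hx
      (trivializationAt E (TangentSpace I : M → Type _) p ⟨p, a⟩).2
    exact (congrArg Prod.snd h :)
  rw [← h1, frame_coordD hx]

lemma extend_eventuallyEq_frame {p : M} (a : TangentSpace I p) :
    (FiberBundle.extend E a : ∀ x : M, TangentSpace I x) =ᶠ[𝓝 p] frame I p (coordD I (extChartAt I p) p a) := by
  filter_upwards [(chartAt H p).open_source.mem_nhds (mem_chart_source H p)] with x hx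
  exact extend_eq_frame hx a

lemma contMDiffAt_extend {p : M} (a : TangentSpace I p) :
    CMDiffAt ∞ (T% (FiberBundle.extend E a : ∀ x : M, TangentSpace I x)) p := by
  refine (contMDiffAt_frame (coordD I (extChartAt I p) p a)
    (mem_chart_source H p)).congr_of_eventuallyEq ?_
  filter_upwards [extend_eventuallyEq_frame a] with x hx
  rw [hx]

/-- The derivative of the chart at `p` is the identity at `p`. -/
lemma coordD_extChartAt_self (p : M) (a : TangentSpace I p) :
    coordD I (extChartAt I p) p a = a := by
  rw [← trivializationAt_apply_eq_coordD (mem_chart_source H p)]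
  exact (tangentBundleCore I M).coordChange_self _ _ (mem_chart_source H p) a

lemma CovariantDerivative.congr_of_eventuallyEq
    (cov : CovariantDerivative I E (TangentSpace I : M → Type _)) {p : M}
    {σ τ : ∀ x : M, TangentSpace I x} (hσ : MDiffAt (T% σ) p) (h : σ =ᶠ[𝓝 p] τ) :
    cov σ p = cov τ p := by
  refine cov.isCovariantDerivativeOn.congr_of_eventuallyEq hσ (hσ.congr_of_eventuallyEq ?_)
    univ_mem h
  filter_upwards [h] with x hx
  rw [hx]

variable {g : ContMDiffRiemannianMetric I ∞ E (TangentSpace I : M → Type _)}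
  {cov : CovariantDerivative I E (TangentSpace I : M → Type _)}

/-- The derivative of a field of the coordinate frame in the direction of another one. -/
lemma localRep_cov_frame (p : M) {y : M} (hy : y ∈ (chartAt H p).source) (a b : E) :
    localRep p (fun x => cov (frame I p b) x (frame I p a x)) =ᶠ[𝓝 (extChartAt I p y)]
      fun z => christoffel cov p z a b := by
  filter_upwards [extChartAt_target_mem_nhds' (mem_target_of_mem_chart_source hy)] with z hz
  have h := coordD_cov_frame cov (mem_chart_source_of_mem_target hz) a b
  rwa [(extChartAt I p).right_inv hz] at h

lemma contMDiffAt_cov_frame (hcov : IsLeviCivita (fun x v w => g.inner x v w) cov) (p : M) {y : M}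
    (hy : y ∈ (chartAt H p).source) (a b : E) :
    CMDiffAt ∞ (T% (fun x => cov (frame I p b) x (frame I p a x))) y := by
  refine contMDiffAt_of_localRep hy
    (ContDiffAt.congr_of_eventuallyEq ?_ (localRep_cov_frame p hy a b))
  have h := (contDiffOn_christoffel_metricRep p hcov).contDiffAt
    (extChartAt_target_mem_nhds' (mem_target_of_mem_chart_source hy))
  exact (h.clm_apply contDiffAt_const).clm_apply contDiffAt_const

lemma coordD_curvature (hcov : IsLeviCivita (fun x v w => g.inner x v w) cov) (p : M)
    (a b c : TangentSpace I p) :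
    coordD I (extChartAt I p) p (curvature cov p a b c)
      = coordCurvature (christoffel cov p) (extChartAt I p p) (coordD I (extChartAt I p) p a)
        (coordD I (extChartAt I p) p b) (coordD I (extChartAt I p) p c) := by
  have hp := mem_chart_source H p
  have hd : DifferentiableAt ℝ (christoffel cov p) (extChartAt I p p) :=
    ((contDiffOn_christoffel_metricRep p hcov).contDiffAt
    (extChartAt_target_mem_nhds' (mem_target_of_mem_chart_source hp))).differentiableAt (by simp)
  set a' := coordD I (extChartAt I p) p a
  set b' := coordD I (extChartAt I p) p b
  set c' := coordD I (extChartAt I p) p c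
  -- Near `p` the inner derivative is the field with components `Γ(w', c')`; differentiating it
  -- produces a derivative of `Γ` and a quadratic term.
  have key : ∀ (v w : TangentSpace I p),
      coordD I (extChartAt I p) p (cov (fun y => cov (FiberBundle.extend E c) y
        (FiberBundle.extend E w y)) p (FiberBundle.extend E v p))
      = fderiv ℝ (christoffel cov p) (extChartAt I p p) (coordD I (extChartAt I p) p v)
          (coordD I (extChartAt I p) p w) c'
        + christoffel cov p (extChartAt I p p) (coordD I (extChartAt I p) p v)
          (christoffel cov p (extChartAt I p p) (coordD I (extChartAt I p) p w) c') := by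
    intro v w
    set w' := coordD I (extChartAt I p) p w
    have h1 : (fun y => cov (FiberBundle.extend E c) y (FiberBundle.extend E w y)) =ᶠ[𝓝 p]
        fun y => cov (frame I p c') y (frame I p w' y) := by
      filter_upwards [eventually_eventually_nhds.2 (extend_eventuallyEq_frame c),
        extend_eventuallyEq_frame w, (chartAt H p).open_source.mem_nhds hp] with y hy hy' hys
      rw [hy']
      refine DFunLike.congr_fun ?_ (frame I p w' y)
      refine (cov.congr_of_eventuallyEq ?_ (EventuallyEq.symm hy)).symm
      exact (contMDiffAt_frame c' hys).mdifferentiableAt (by simp)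
    have h2 := (contMDiffAt_cov_frame hcov p hp w' c').mdifferentiableAt (by simp)
    rw [← cov.congr_of_eventuallyEq h2 h1.symm, FiberBundle.extend_apply_self, coordD_cov cov hp h2,
      coordD_cov_frame cov hp, (localRep_cov_frame p hp w' c').fderiv_eq]
    obtain ⟨D, hD, hD'⟩ := hasFDerivAt_bilin hd.hasFDerivAt (hasFDerivAt_const w' _)
      (hasFDerivAt_const c' _)
    rw [hD.fderiv, hD']
    simp
  have hb : VectorField.mlieBracket I (FiberBundle.extend E a : ∀ x : M, TangentSpace I x)
      (FiberBundle.extend E b) p = 0 := by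
    rw [(extend_eventuallyEq_frame a).mlieBracket_vectorField_eq (extend_eventuallyEq_frame b)]
    exact mlieBracket_frame _ _ hp
  rw [curvature, curvatureField, hb, map_zero, sub_zero, map_sub, key, key, coordCurvature]
  abel

end CurvatureCoordinates

/-! ### Charts of the tangent bundle and the connection map. -/

section TangentBundleCoordinates

set_option linter.unusedSectionVars false

variable {E : Type*} [NormedAddCommGroup E] [NormedSpace ℝ E] [FiniteDimensional ℝ E]
  {H : Type*} [TopologicalSpace H] {I : ModelWithCorners ℝ E H} [I.Boundaryless]
  {M : Type*} [TopologicalSpace M] [ChartedSpace H M] [IsManifold I ∞ M]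

lemma mem_chartAt_source_tangentBundle {P Q : TangentBundle I M} :
    Q ∈ (chartAt (ModelProd H E) P).source ↔ Q.proj ∈ (chartAt H P.proj).source := by
  simp only [TangentBundle.mem_chart_source_iff]

lemma extChartAt_tangentBundle {P Q : TangentBundle I M}
    (hQ : Q.proj ∈ (chartAt H P.proj).source) :
    extChartAt I.tangent P Q
      = (extChartAt I P.proj Q.proj, coordD I (extChartAt I P.proj) Q.proj Q.snd) := by
  rw [← trivializationAt_apply_eq_coordD hQ]
  rfl

lemma extChartAt_tangentBundle_self (P : TangentBundle I M) :
    extChartAt I.tangent P P = (extChartAt I P.proj P.proj, P.snd) := by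
  rw [extChartAt_tangentBundle (mem_chart_source H _), coordD_extChartAt_self]
  rfl

lemma eventually_mem_chartAt_source {P Q : TangentBundle I M}
    (hQ : Q.proj ∈ (chartAt H P.proj).source) :
    ∀ᶠ R : TangentBundle I M in 𝓝 Q, R.proj ∈ (chartAt H P.proj).source := by
  filter_upwards [(chartAt (ModelProd H E) P).open_source.mem_nhds
    (mem_chartAt_source_tangentBundle.2 hQ)] with R hR
  exact mem_chartAt_source_tangentBundle.1 hR

lemma hasMFDerivAt_extend (p : M) (u : TangentSpace I p) :
    HasMFDerivAt I I.tangent (fun x => (⟨x, FiberBundle.extend E u x⟩ : TangentBundle I M)) p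
      (ContinuousLinearMap.inl ℝ E E) := by
  refine ⟨(contMDiffAt_extend u).continuousAt, ?_⟩
  have h1 : HasFDerivWithinAt (fun z : E => (z, (show E from u))) (ContinuousLinearMap.inl ℝ E E) (range I)
    (extChartAt I p p) := (hasFDerivAt_prodMk_left _ _).hasFDerivWithinAt
  have key : ∀ x ∈ (chartAt H p).source, extChartAt I.tangent
      (⟨p, FiberBundle.extend E u p⟩ : TangentBundle I M) ⟨x, FiberBundle.extend E u x⟩
      = (extChartAt I p x, (show E from u)) := by
    intro x hx
    rw [extChartAt_tangentBundle hx]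
    dsimp only
    rw [extend_eq_frame hx, coordD_frame _ hx, coordD_extChartAt_self]
  refine h1.congr_of_eventuallyEq ?_ ?_
  · filter_upwards [extChartAt_target_mem_nhdsWithin (I := I) p] with z hz
    refine (key _ (mem_chart_source_of_mem_target hz)).trans ?_
    rw [(extChartAt I p).right_inv hz]
  · refine (key _ ?_).trans ?_
    · rw [extChartAt_to_inv]; exact mem_chart_source H p
    · rw [extChartAt_to_inv]

/-- The first component of a tangent vector of the tangent bundle in a chart. -/
lemma coordD_tangentBundle_fst {P Q : TangentBundle I M}
    (hQ : Q.proj ∈ (chartAt H P.proj).source) (ξ : TangentSpace I.tangent Q) :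
    (coordD I.tangent (extChartAt I.tangent P) Q ξ).1
      = coordD I (extChartAt I P.proj) Q.proj (dproj Q ξ) := by
  have h1 : MDifferentiableAt I.tangent 𝓘(ℝ, E × E) (extChartAt I.tangent P) Q :=
    (contMDiffAt_extChartAt_infty P (mem_chartAt_source_tangentBundle.2 hQ)).mdifferentiableAt
      (by simp)
  have h2 := ((hasFDerivAt_fst (𝕜 := ℝ) (E := E) (F := E)
    (p := extChartAt I.tangent P Q)).hasMFDerivAt).comp Q h1.hasMFDerivAt
  have h3 : MDifferentiableAt I 𝓘(ℝ, E) (extChartAt I P.proj) Q.proj :=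
    (contMDiffAt_extChartAt_infty P.proj hQ).mdifferentiableAt (by simp)
  have h4 := h3.hasMFDerivAt.comp Q (hasMFDerivAt_proj Q).mdifferentiableAt.hasMFDerivAt
  have h5 : (extChartAt I P.proj ∘ fun R : TangentBundle I M => R.proj) =ᶠ[𝓝 Q]
      Prod.fst ∘ extChartAt I.tangent P := Eventually.of_forall fun R => rfl
  have h6 := hasMFDerivAt_unique (h2.congr_of_eventuallyEq h5) h4
  exact DFunLike.congr_fun h6 ξ

/-- The second component of a tangent vector of the tangent bundle in a chart. -/
lemma coordD_connectionMap (cov : CovariantDerivative I E (TangentSpace I : M → Type _))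
    {P Q : TangentBundle I M}
    (hQ : Q.proj ∈ (chartAt H P.proj).source) (ξ : TangentSpace I.tangent Q) :
    coordD I (extChartAt I P.proj) Q.proj (connectionMap cov Q ξ)
      = (coordD I.tangent (extChartAt I.tangent P) Q ξ).2
        + christoffel cov P.proj (extChartAt I P.proj Q.proj)
          (coordD I.tangent (extChartAt I.tangent P) Q ξ).1
          (coordD I (extChartAt I P.proj) Q.proj Q.snd) := by
  have h1 : MDifferentiableAt I.tangent 𝓘(ℝ, E × E) (extChartAt I.tangent P) Q :=
    (contMDiffAt_extChartAt_infty P (mem_chartAt_source_tangentBundle.2 hQ)).mdifferentiableAt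
      (by simp)
  set D : E × E →L[ℝ] E :=
    ContinuousLinearMap.snd ℝ E E ∘L coordD I.tangent (extChartAt I.tangent P) Q with hD
  have h2 : HasMFDerivAt I.tangent 𝓘(ℝ, E) (fun R : TangentBundle I M =>
      (extChartAt I.tangent P R).2) Q D :=
    ((hasFDerivAt_snd (𝕜 := ℝ) (E := E) (F := E)
      (p := extChartAt I.tangent P Q)).hasMFDerivAt).comp Q h1.hasMFDerivAt
  -- The point `⟨Q.proj, FiberBundle.extend E Q.snd Q.proj⟩` used below equals `Q` only
  -- propositionally, so the derivative is stated at any point equal to `Q`.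
  have h2' : ∀ R : TangentBundle I M, R = Q → HasMFDerivAt I.tangent 𝓘(ℝ, E)
      (fun R : TangentBundle I M => (extChartAt I.tangent P R).2) R D := by
    rintro R rfl
    exact h2
  have hext := (contMDiffAt_extend Q.snd).mdifferentiableAt (by simp)
  -- In the preferred coordinates at `Q`, the vector `(0, b)` is the velocity of a line in the
  -- fiber, on which the chart at `P` is linear.
  have hv : ∀ b : E, D (0, b) = coordD I (extChartAt I P.proj) Q.proj b := by
    intro b
    let L : E →L[ℝ] E := coordD I (extChartAt I P.proj) Q.proj
    let v : E := Q.snd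
    have h3 := HasMFDerivAt.comp v h2 (hasMFDerivAt_fiberIncl Q)
    have h4 : HasMFDerivAt 𝓘(ℝ, E) 𝓘(ℝ, E) L v L := L.hasFDerivAt.hasMFDerivAt
    have h5 : HasMFDerivAt 𝓘(ℝ, E) 𝓘(ℝ, E) L v (D ∘L ContinuousLinearMap.inr ℝ E E) :=
      h3.congr_of_eventuallyEq (Eventually.of_forall fun w =>
        (congrArg Prod.snd (extChartAt_tangentBundle (P := P) (Q := ⟨Q.proj, w⟩) hQ)).symm)
    exact DFunLike.congr_fun (hasMFDerivAt_unique h5 h4) b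
  -- `(a, 0)` is tangent to the section extending `Q.snd` constantly. The resulting derivative is
  -- the one occurring in the covariant derivative of this extension, so the sum is the connection
  -- map.
  have hh : ∀ a : E, D (a, 0) = fderiv ℝ (localRep P.proj (FiberBundle.extend E Q.snd))
      (extChartAt I P.proj Q.proj) (coordD I (extChartAt I P.proj) Q.proj a) := by
    intro a
    have h3 := (h2' ⟨Q.proj, FiberBundle.extend E Q.snd Q.proj⟩
      (by rw [FiberBundle.extend_apply_self])).comp Q.proj (hasMFDerivAt_extend Q.proj Q.snd)
    have hd : MDifferentiableAt I 𝓘(ℝ, E) (fun x => coordD I (extChartAt I P.proj) x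
        (FiberBundle.extend E Q.snd x)) Q.proj :=
      MDifferentiableAt.coordD_apply
        ((contMDiffAt_extChartAt_infty P.proj hQ).of_le (by norm_cast)) hext
    have h4 : HasMFDerivAt I 𝓘(ℝ, E) (fun x => coordD I (extChartAt I P.proj) x
        (FiberBundle.extend E Q.snd x)) Q.proj (D ∘L ContinuousLinearMap.inl ℝ E E) := by
      refine h3.congr_of_eventuallyEq ?_
      filter_upwards [(chartAt H P.proj).open_source.mem_nhds hQ] with x hx
      exact (congrArg Prod.snd (extChartAt_tangentBundle (P := P)
        (Q := ⟨x, FiberBundle.extend E Q.snd x⟩) hx)).symm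
    have h5 := coordD_eq_fderiv_comp hQ hd a
    rw [coordD, h4.mfderiv] at h5
    exact h5
  have hξ : (coordD I.tangent (extChartAt I.tangent P) Q ξ).2
      = D ((show E × E from ξ).1, 0) + D (0, (show E × E from ξ).2) := by
    rw [← map_add, Prod.mk_add_mk, add_zero, zero_add]
    rfl
  rw [connectionMap_apply, map_add, coordD_cov cov hQ hext, coordD_tangentBundle_fst hQ, hξ, hh, hv,
    FiberBundle.extend_apply_self, dproj_apply]
  abel

end TangentBundleCoordinates

set_option synthInstance.maxHeartbeats 200000 in
lemma differentiableAt_coordLiftMetric {E : Type*} [NormedAddCommGroup E] [NormedSpace ℝ E]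
    {Γ : E → E →L[ℝ] E →L[ℝ] E} {G : E → E →L[ℝ] E →L[ℝ] ℝ} {q : E × E}
    (hd : DifferentiableAt ℝ Γ q.1) (hG : DifferentiableAt ℝ G q.1) (m₁ m₂ m₃ : ℝ) (η ζ : E × E) :
    DifferentiableAt ℝ (fun q => coordLiftMetric m₁ m₂ m₃ G Γ q η ζ) q := by
  have h1 : DifferentiableAt ℝ (fun q : E × E => G q.1) q :=
    (hasFDerivAt_comp_fst (W := E →L[ℝ] E →L[ℝ] ℝ) hG q.2).differentiableAt
  have h2 : DifferentiableAt ℝ (fun q : E × E => Γ q.1) q :=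
    (hasFDerivAt_comp_fst (W := E →L[ℝ] E →L[ℝ] E) hd q.2).differentiableAt
  have h3 : ∀ η : E × E, DifferentiableAt ℝ (fun q : E × E => η.2 + Γ q.1 η.1 q.2) q := fun η =>
    ((h2.clm_apply (differentiableAt_const η.1)).clm_apply differentiableAt_snd).const_add _
  have h4 : ∀ {a b : E × E → E}, DifferentiableAt ℝ a q → DifferentiableAt ℝ b q →
      DifferentiableAt ℝ (fun q => G q.1 (a q) (b q)) q := fun ha hb =>
    (h1.clm_apply ha).clm_apply hb
  exact ((((h4 (differentiableAt_const _) (differentiableAt_const _)).const_mul m₁).add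
    (((h4 (differentiableAt_const _) (h3 ζ)).add (h4 (h3 η) (differentiableAt_const _))).const_mul
      m₂)).add ((h4 (h3 η) (h3 ζ)).const_mul m₃))

/-! ### Lifts and the lifted metric in induced coordinates. -/

section LiftCoordinates

set_option linter.unusedSectionVars false

variable {E : Type*} [NormedAddCommGroup E] [NormedSpace ℝ E] [FiniteDimensional ℝ E]
  {H : Type*} [TopologicalSpace H] {I : ModelWithCorners ℝ E H} [I.Boundaryless]
  {M : Type*} [TopologicalSpace M] [ChartedSpace H M] [IsManifold I ∞ M]
  (cov : CovariantDerivative I E (TangentSpace I : M → Type _)) {P Q : TangentBundle I M}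

lemma connectionMap_add (ξ η : TangentSpace I.tangent Q) :
    connectionMap cov Q (ξ + η) = connectionMap cov Q ξ + connectionMap cov Q η := by
  simp only [connectionMap_apply, map_add]
  change ((show E × E from ξ).2 + (show E × E from η).2 : E) + _ = _
  abel

lemma connectionMap_zero : connectionMap cov Q 0 = 0 := by
  have h := connectionMap_add cov (0 : TangentSpace I.tangent Q) 0
  rw [add_zero] at h
  exact left_eq_add.1 h

/-- Tangent vectors of the tangent bundle are determined by their components in a chart. -/
lemma eq_of_coordD_eq {N : Type*} [TopologicalSpace N] [ChartedSpace H N] [IsManifold I ∞ N]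
    {x₀ y : N} (hy : y ∈ (chartAt H x₀).source) {v w : TangentSpace I y}
    (h : coordD I (extChartAt I x₀) y v = coordD I (extChartAt I x₀) y w) : v = w := by
  rw [← frame_coordD hy v, h, frame_coordD hy]

lemma coordD_hlift (hQ : Q.proj ∈ (chartAt H P.proj).source) (a : TangentSpace I Q.proj) :
    coordD I.tangent (extChartAt I.tangent P) Q (hlift cov Q a)
      = (coordD I (extChartAt I P.proj) Q.proj a,
        -christoffel cov P.proj (extChartAt I P.proj Q.proj)
          (coordD I (extChartAt I P.proj) Q.proj a)
          (coordD I (extChartAt I P.proj) Q.proj Q.snd)) := by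
  have h1 := coordD_tangentBundle_fst hQ (hlift cov Q a)
  have h2 := coordD_connectionMap cov hQ (hlift cov Q a)
  rw [dproj_hlift] at h1
  rw [connectionMap_hlift, map_zero, h1] at h2
  exact Prod.ext h1 (eq_neg_of_add_eq_zero_left h2.symm)

lemma coordD_vlift (cov : CovariantDerivative I E (TangentSpace I : M → Type _))
    {P Q : TangentBundle I M} (hQ : Q.proj ∈ (chartAt H P.proj).source) (b : TangentSpace I Q.proj) :
    coordD I.tangent (extChartAt I.tangent P) Q (vlift Q b)
      = (0, coordD I (extChartAt I P.proj) Q.proj b) := by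
  have h1 := coordD_tangentBundle_fst hQ (vlift Q b)
  have h2 := coordD_connectionMap cov hQ (vlift Q b)
  rw [dproj_vlift, map_zero] at h1
  rw [connectionMap_vlift, h1, map_zero, zero_apply, add_zero] at h2
  exact Prod.ext h1 h2.symm

/-- A vector field is determined by its components in a chart. -/
lemma localRep_eventuallyEq {N : Type*} [TopologicalSpace N] [ChartedSpace H N] [IsManifold I ∞ N]
    {x₀ y : N} (hy : y ∈ (chartAt H x₀).source) {σ : ∀ x : N, TangentSpace I x} {f : E → E}
    (h : ∀ x ∈ (chartAt H x₀).source,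
      coordD I (extChartAt I x₀) x (σ x) = f (extChartAt I x₀ x)) :
    localRep x₀ σ =ᶠ[𝓝 (extChartAt I x₀ y)] f := by
  filter_upwards [extChartAt_target_mem_nhds' (mem_target_of_mem_chart_source hy)] with z hz
  rw [localRep, h _ (mem_chart_source_of_mem_target hz), (extChartAt I x₀).right_inv hz]

/-- The components of `A^h + B^v` in induced coordinates. -/
lemma coordD_liftField (A B : ∀ x : M, TangentSpace I x)
    (hQ : Q.proj ∈ (chartAt H P.proj).source) :
    coordD I.tangent (extChartAt I.tangent P) Q (liftField cov A B Q)
      = (fun q : E × E => (localRep P.proj A q.1, localRep P.proj B q.1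
          - christoffel cov P.proj q.1 (localRep P.proj A q.1) q.2)) (extChartAt I.tangent P Q) := by
  rw [liftField, map_add, coordD_hlift cov hQ, coordD_vlift cov hQ, extChartAt_tangentBundle hQ]
  simp only [localRep_apply _ hQ, Prod.mk_add_mk, add_zero]
  rw [neg_add_eq_sub]

lemma localRep_liftField (A B : ∀ x : M, TangentSpace I x)
    (hQ : Q.proj ∈ (chartAt H P.proj).source) :
    localRep P (liftField cov A B) =ᶠ[𝓝 (extChartAt I.tangent P Q)]
      fun q : E × E => (localRep P.proj A q.1, localRep P.proj B q.1
          - christoffel cov P.proj q.1 (localRep P.proj A q.1) q.2) :=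
  localRep_eventuallyEq (mem_chartAt_source_tangentBundle.2 hQ) fun _ hR =>
    coordD_liftField cov A B (mem_chartAt_source_tangentBundle.1 hR)

variable (g : ContMDiffRiemannianMetric I ∞ E (TangentSpace I : M → Type _)) (m₁ m₂ m₃ : ℝ)

lemma liftMetric_eq_coordLiftMetric (hQ : Q.proj ∈ (chartAt H P.proj).source)
    (ξ η : TangentSpace I.tangent Q) :
    liftMetric (fun x v w => g.inner x v w) cov m₁ m₂ m₃ Q ξ η
      = coordLiftMetric m₁ m₂ m₃ (metricRep g.inner P.proj) (christoffel cov P.proj)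
          (extChartAt I.tangent P Q) (coordD I.tangent (extChartAt I.tangent P) Q ξ)
          (coordD I.tangent (extChartAt I.tangent P) Q η) := by
  rw [coordLiftMetric, liftMetric, extChartAt_tangentBundle hQ]
  dsimp only
  rw [← coordD_connectionMap cov hQ ξ, ← coordD_connectionMap cov hQ η,
    coordD_tangentBundle_fst hQ, coordD_tangentBundle_fst hQ]
  simp only [metricRep_coordD g.inner hQ]

end LiftCoordinates

/-! ### The covariant derivative of a lifted field. -/

section LiftFieldDerivative

set_option linter.unusedSectionVars false

variable {E : Type*} [NormedAddCommGroup E] [NormedSpace ℝ E] [FiniteDimensional ℝ E]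
  {H : Type*} [TopologicalSpace H] {I : ModelWithCorners ℝ E H} [I.Boundaryless]
  {M : Type*} [TopologicalSpace M] [ChartedSpace H M] [IsManifold I ∞ M]
  {g : ContMDiffRiemannianMetric I ∞ E (TangentSpace I : M → Type _)}
  {cov : CovariantDerivative I E (TangentSpace I : M → Type _)}
  {m₁ m₂ m₃ : ℝ}
  {covT : CovariantDerivative I.tangent (E × E)
      (TangentSpace I.tangent : TangentBundle I M → Type _)}

lemma differentiableAt_christoffel (hcov : IsLeviCivita (fun x v w => g.inner x v w) cov) (p : M) :
    DifferentiableAt ℝ (christoffel cov p) (extChartAt I p p) :=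
  ((contDiffOn_christoffel_metricRep p hcov).contDiffAt
    (extChartAt_target_mem_nhds p)).differentiableAt (by simp)

lemma contDiffAt_metricRep (g : ContMDiffRiemannianMetric I ∞ E (TangentSpace I : M → Type _))
    (p : M) : ContDiffAt ℝ ∞ (metricRep g.inner p) (extChartAt I p p) :=
  (contDiffOn_metricRep g p).contDiffAt (extChartAt_target_mem_nhds p)

lemma liftMetric_frame_eventuallyEq (P : TangentBundle I M) (b c : E × E) :
    (fun Q => liftMetric (fun x v w => g.inner x v w) cov m₁ m₂ m₃ Q
      (frame I.tangent P b Q) (frame I.tangent P c Q)) =ᶠ[𝓝 P]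
    (fun q => coordLiftMetric m₁ m₂ m₃ (metricRep g.inner P.proj) (christoffel cov P.proj) q b c)
      ∘ extChartAt I.tangent P := by
  filter_upwards [eventually_mem_chartAt_source (P := P) (mem_chart_source H P.proj)] with Q hQ
  have hQ' := mem_chartAt_source_tangentBundle.2 hQ
  rw [liftMetric_eq_coordLiftMetric cov g m₁ m₂ m₃ hQ, coordD_frame _ hQ', coordD_frame _ hQ']
  rfl

/-- Metric compatibility on `TM`, tested on the coordinate frame; this is the hypothesis `hT` of
`coordLiftMetric_christoffel`. -/
lemma fderiv_coordLiftMetric_eq (hcov : IsLeviCivita (fun x v w => g.inner x v w) cov)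
    (hcovT : IsLeviCivita (liftMetric (fun x v w => g.inner x v w) cov m₁ m₂ m₃) covT)
    (P : TangentBundle I M) (a b c : E × E) :
    fderiv ℝ (fun q => coordLiftMetric m₁ m₂ m₃ (metricRep g.inner P.proj)
        (christoffel cov P.proj) q b c) (extChartAt I.tangent P P) a
      = coordLiftMetric m₁ m₂ m₃ (metricRep g.inner P.proj) (christoffel cov P.proj)
          (extChartAt I.tangent P P) (christoffel covT P (extChartAt I.tangent P P) a b) c
        + coordLiftMetric m₁ m₂ m₃ (metricRep g.inner P.proj) (christoffel cov P.proj)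
          (extChartAt I.tangent P P) b (christoffel covT P (extChartAt I.tangent P P) a c) := by
  have hP := mem_chart_source (ModelProd H E) P
  have hp := mem_chart_source H P.proj
  have hd : DifferentiableAt ℝ (fun q => coordLiftMetric m₁ m₂ m₃ (metricRep g.inner P.proj)
      (christoffel cov P.proj) q b c) (extChartAt I.tangent P P) := by
    apply differentiableAt_coordLiftMetric
    · rw [extChartAt_tangentBundle_self]
      exact differentiableAt_christoffel hcov P.proj
    · rw [extChartAt_tangentBundle_self]
      exact (contDiffAt_metricRep g P.proj).differentiableAt (by simp)
  have hm : MDifferentiableAt I.tangent 𝓘(ℝ, ℝ)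
      (fun Q => liftMetric (fun x v w => g.inner x v w) cov m₁ m₂ m₃ Q
        (frame I.tangent P b Q) (frame I.tangent P c Q)) P := by
    refine MDifferentiableAt.congr_of_eventuallyEq ?_ (liftMetric_frame_eventuallyEq P b c)
    exact hd.mdifferentiableAt.comp P
      ((contMDiffAt_extChartAt_infty P hP).mdifferentiableAt (by simp))
  have h := christoffel_compatible hcovT hP b c hm a
  rw [liftMetric_eq_coordLiftMetric cov g m₁ m₂ m₃ hp,
    liftMetric_eq_coordLiftMetric cov g m₁ m₂ m₃ hp] at h
  simp only [coordD_frame _ hP] at h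
  rw [← h]
  refine congrArg (fun D : E × E →L[ℝ] ℝ => D a) (EventuallyEq.fderiv_eq ?_)
  filter_upwards [extChartAt_target_mem_nhds (I := I.tangent) P] with z hz
  have hz' := mem_chart_source_of_mem_target hz
  rw [liftMetric_eq_coordLiftMetric cov g m₁ m₂ m₃ (mem_chartAt_source_tangentBundle.1 hz'),
    coordD_frame _ hz', coordD_frame _ hz', (extChartAt I.tangent P).right_inv hz]

set_option synthInstance.maxHeartbeats 200000 in
lemma fderiv_liftField_coord {Γ : E → E →L[ℝ] E →L[ℝ] E} {α β : E → E} {z v : E}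
    (hΓ : DifferentiableAt ℝ Γ z) (hα : DifferentiableAt ℝ α z) (hβ : DifferentiableAt ℝ β z)
    (a b : E) :
    fderiv ℝ (fun q : E × E => (α q.1, β q.1 - Γ q.1 (α q.1) q.2)) (z, v) (a, b)
      = (fderiv ℝ α z a, fderiv ℝ β z a
        - (fderiv ℝ Γ z a (α z) v + Γ z (fderiv ℝ α z a) v + Γ z (α z) b)) := by
  have h1 := hasFDerivAt_comp_fst hα v
  have h2 := hasFDerivAt_comp_fst hβ v
  have h3 := hasFDerivAt_comp_fst (W := E →L[ℝ] E →L[ℝ] E) hΓ v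
  obtain ⟨D, h4, hD⟩ := hasFDerivAt_bilin h3 h1 hasFDerivAt_snd
  have h5 : HasFDerivAt (fun q : E × E => (α q.1, β q.1 - Γ q.1 (α q.1) q.2)) _ (z, v) :=
    h1.prodMk (h2.sub h4)
  rw [h5.fderiv]
  simp [hD]

lemma contDiffAt_comp_fst {W : Type*} [NormedAddCommGroup W] [NormedSpace ℝ W] {n : ℕ∞ω}
    {f : E → W} {z : E} (hf : ContDiffAt ℝ n f z) (v : E) :
    ContDiffAt ℝ n (fun q : E × E => f q.1) (z, v) :=
  ContDiffAt.comp (f := Prod.fst) (z, v) hf contDiffAt_fst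

variable {A B : ∀ x : M, TangentSpace I x} {P : TangentBundle I M}

lemma contMDiffAt_liftField (hcov : IsLeviCivita (fun x v w => g.inner x v w) cov)
    (hA : CMDiffAt ∞ (T% A) P.proj) (hB : CMDiffAt ∞ (T% B) P.proj) :
    CMDiffAt ∞ (T% (liftField cov A B)) P := by
  have hp := mem_chart_source H P.proj
  refine contMDiffAt_of_localRep (mem_chart_source (ModelProd H E) P)
    (ContDiffAt.congr_of_eventuallyEq ?_ (localRep_liftField cov A B hp))
  rw [extChartAt_tangentBundle_self]
  let v : E := P.snd
  have h1 := contDiffAt_comp_fst (contDiffAt_localRep hp hA) v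
  have h2 := contDiffAt_comp_fst (contDiffAt_localRep hp hB) v
  have h3 := contDiffAt_comp_fst ((contDiffOn_christoffel_metricRep P.proj hcov).contDiffAt
    (extChartAt_target_mem_nhds P.proj)) v
  exact h1.prodMk (h2.sub ((h3.clm_apply h1).clm_apply contDiffAt_snd))

/-- The covariant derivative of `A^h + B^v`. -/
theorem cov_liftField (hcov : IsLeviCivita (fun x v w => g.inner x v w) cov)
    (hcovT : IsLeviCivita (liftMetric (fun x v w => g.inner x v w) cov m₁ m₂ m₃) covT)
    (hm : m₁ * m₃ - m₂ ^ 2 ≠ 0)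
    (hA : CMDiffAt ∞ (T% A) P.proj) (hB : CMDiffAt ∞ (T% B) P.proj) (F G : TangentSpace I P.proj) :
    dproj P (covT (liftField cov A B) P (hlift cov P F + vlift P G))
      = cov A P.proj F + (m₁ * m₃ - m₂ ^ 2)⁻¹ •
        ((m₂ * m₃) • curvature cov P.proj P.snd F (A P.proj)
          + (m₂ * m₃ / 2) • curvature cov P.proj F (A P.proj) P.snd
          + (m₃ ^ 2 / 2) • curvature cov P.proj P.snd (B P.proj) F
          + (m₃ ^ 2 / 2) • curvature cov P.proj P.snd G (A P.proj)) ∧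
    connectionMap cov P (covT (liftField cov A B) P (hlift cov P F + vlift P G))
      = cov B P.proj F + (m₁ * m₃ - m₂ ^ 2)⁻¹ •
        (-(m₂ ^ 2) • curvature cov P.proj P.snd F (A P.proj)
          - (m₁ * m₃ / 2) • curvature cov P.proj F (A P.proj) P.snd
          - (m₂ * m₃ / 2) • curvature cov P.proj P.snd (B P.proj) F
          - (m₂ * m₃ / 2) • curvature cov P.proj P.snd G (A P.proj)) := by
  have hP := mem_chart_source (ModelProd H E) P
  have hp := mem_chart_source H P.proj
  have hA' := contDiffAt_localRep hp hA
  have hB' := contDiffAt_localRep hp hB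
  have hz : extChartAt I.tangent P P
      = (extChartAt I P.proj P.proj, coordD I (extChartAt I P.proj) P.proj P.snd) :=
    extChartAt_tangentBundle hp
  -- The Christoffel symbols of `TM` at the lifts with components `(F, G)` and `(A, B)`.
  have hC := coordLiftMetric_christoffel (differentiableAt_christoffel hcov P.proj)
    ((contDiffAt_metricRep g P.proj).of_le (by norm_cast))
    (by
      filter_upwards [extChartAt_target_mem_nhds (I := I) P.proj] with y hy
      exact christoffel_symm_of_mem_target P.proj hcov hy)
    (by
      filter_upwards [extChartAt_target_mem_nhds (I := I) P.proj] with y hy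
      exact isMetricCoord_metricRep P.proj hcov hy)
    (metricRep_symm g P.proj _)
    (metricRep_nondegenerate g P.proj (mem_extChartAt_target P.proj)) hm
    (fun a b => christoffel covT P (extChartAt I.tangent P P) a b)
    (fun a b => christoffel_symm hcovT hP a b)
    (v := coordD I (extChartAt I P.proj) P.proj P.snd)
    (fun a b c => by
      have h := fderiv_coordLiftMetric_eq hcov hcovT P a b c
      rw [← hz]
      exact h)
    (coordD I (extChartAt I P.proj) P.proj F) (coordD I (extChartAt I P.proj) P.proj G)
    (coordD I (extChartAt I P.proj) P.proj (A P.proj))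
    (coordD I (extChartAt I P.proj) P.proj (B P.proj))
  have hξ : coordD I.tangent (extChartAt I.tangent P) P (hlift cov P F + vlift P G)
      = (coordD I (extChartAt I P.proj) P.proj F, coordD I (extChartAt I P.proj) P.proj G
        - christoffel cov P.proj (extChartAt I P.proj P.proj)
          (coordD I (extChartAt I P.proj) P.proj F)
          (coordD I (extChartAt I P.proj) P.proj P.snd)) := by
    rw [map_add, coordD_hlift cov hp, coordD_vlift cov hp, Prod.mk_add_mk, add_zero, neg_add_eq_sub]
  have hL : coordD I.tangent (extChartAt I.tangent P) P (liftField cov A B P)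
      = (coordD I (extChartAt I P.proj) P.proj (A P.proj),
        coordD I (extChartAt I P.proj) P.proj (B P.proj)
        - christoffel cov P.proj (extChartAt I P.proj P.proj)
          (coordD I (extChartAt I P.proj) P.proj (A P.proj))
          (coordD I (extChartAt I P.proj) P.proj P.snd)) := by
    rw [liftField, map_add, coordD_hlift cov hp, coordD_vlift cov hp, Prod.mk_add_mk, add_zero,
      neg_add_eq_sub]
  have hcT := coordD_cov covT hP ((contMDiffAt_liftField hcov hA hB).mdifferentiableAt (by simp))
    (hlift cov P F + vlift P G)
  rw [hξ, hL, (localRep_liftField cov A B hp).fderiv_eq, hz, fderiv_liftField_coord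
    (differentiableAt_christoffel hcov P.proj) (hA'.differentiableAt (by simp))
    (hB'.differentiableAt (by simp)), ← hz] at hcT
  have h1 := coordD_tangentBundle_fst hp
    (covT (liftField cov A B) P (hlift cov P F + vlift P G))
  have h2 := coordD_connectionMap cov hp
    (covT (liftField cov A B) P (hlift cov P F + vlift P G))
  have hcA := coordD_cov cov hp (hA.mdifferentiableAt (by simp)) F
  have hcB := coordD_cov cov hp (hB.mdifferentiableAt (by simp)) F
  rw [hcT] at h1 h2
  simp only [localRep_apply _ hp, Prod.fst_add, Prod.snd_add] at h1 h2
  obtain ⟨hC1, hC2⟩ := hC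
  constructor
  · refine eq_of_coordD_eq hp ?_
    rw [← h1]
    simp only [map_add, map_smul, coordD_curvature hcov, hcA]
    linear_combination (norm := module) hC1
  -- The derivative of `-Γ(A, v)`, the correction in the fiber component of `A^h + B^v`, cancels the
  -- terms with `dΓ` and `Γ Γ` in `hC2` and leaves `∇_F B` and the curvature.
  · refine eq_of_coordD_eq hp ?_
    rw [h2]
    simp only [map_add, map_sub, map_smul, add_apply, coordD_curvature hcov, hcB]
    linear_combination (norm := module) hC2

end LiftFieldDerivative

/-! ### The coordinates of the tangent bundle induced by an arbitrary chart. -/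

section InducedChart

set_option linter.unusedSectionVars false

variable {E : Type*} [NormedAddCommGroup E] [NormedSpace ℝ E] [FiniteDimensional ℝ E]
  {H : Type*} [TopologicalSpace H] {I : ModelWithCorners ℝ E H} [I.Boundaryless]
  {M : Type*} [TopologicalSpace M] [ChartedSpace H M] [IsManifold I ∞ M]
  {φ : OpenPartialHomeomorph M H}

/-- The induced chart is the tangent map of the chart, read in the model space. -/
lemma contMDiffAt_inducedChart (hφ : φ ∈ IsManifold.maximalAtlas I ∞ M) {P : TangentBundle I M}
    (hP : P.proj ∈ φ.source) :
    ContMDiffAt I.tangent 𝓘(ℝ, E × E) ∞ (inducedChart (I := I) φ) P := by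
  have h1 : ContMDiffOn I 𝓘(ℝ, E) ∞ (φ.extend I) φ.source := φ.contMDiffOn_extend hφ
  have hu : UniqueMDiffOn I φ.source := φ.open_source.uniqueMDiffOn
  have hs : IsOpen ((fun Q : TangentBundle I M => Q.proj) ⁻¹' φ.source) :=
    φ.open_source.preimage (FiberBundle.continuous_proj E (TangentSpace I : M → Type _))
  have h2 := (h1.contMDiffOn_tangentMapWithin (m := ∞) (by simp) hu).contMDiffAt
    (hs.mem_nhds hP)
  have h3 : ContMDiffAt I.tangent 𝓘(ℝ, E).tangent ∞ (tangentMap I 𝓘(ℝ, E) (φ.extend I)) P := by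
    refine h2.congr_of_eventuallyEq ?_
    filter_upwards [hs.mem_nhds hP] with Q hQ
    exact (tangentMapWithin_eq_tangentMap (hu _ hQ)
      ((h1.contMDiffAt (φ.open_source.mem_nhds hQ)).mdifferentiableAt (by simp))).symm
  have h4 : ContMDiffAt I.tangent 𝓘(ℝ, E) ∞ (fun Q => φ.extend I Q.proj) P :=
    (h1.contMDiffAt (φ.open_source.mem_nhds hP)).comp P
      (Bundle.contMDiff_proj (TangentSpace I : M → Type _)).contMDiffAt
  have h5 : ContMDiffAt I.tangent 𝓘(ℝ, E) ∞
      (fun Q => (mfderiv I 𝓘(ℝ, E) (φ.extend I) Q.proj Q.snd : E)) P :=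
    (contMDiff_snd_tangentBundle_modelSpace E 𝓘(ℝ, E)).contMDiffAt.comp P h3
  exact h4.prodMk_space h5

lemma coordD_extend_injective (hφ : φ ∈ IsManifold.maximalAtlas I ∞ M) {p : M}
    (hp : p ∈ φ.source) : Function.Injective (coordD I (φ.extend I) p) := by
  have h1 : MDifferentiableAt I 𝓘(ℝ, E) (φ.extend I) p :=
    ((φ.contMDiffOn_extend hφ).contMDiffAt (φ.open_source.mem_nhds hp)).mdifferentiableAt (by simp)
  have h2 : MDifferentiableAt 𝓘(ℝ, E) I (φ.extend I).symm (φ.extend I p) := by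
    have h3 := contMDiffOn_extend_symm hφ
    rw [← φ.extend_target'] at h3
    refine (h3.contMDiffAt (φ.isOpen_extend_target.mem_nhds ?_)).mdifferentiableAt (by simp)
    exact (φ.extend I).map_source (by rwa [φ.extend_source])
  have h3 := h2.hasMFDerivAt.comp p h1.hasMFDerivAt
  have h4 := hasMFDerivAt_unique (h3.congr_of_eventuallyEq (f₁ := id) ?_) (hasMFDerivAt_id p)
  · refine Function.LeftInverse.injective (g := mfderiv 𝓘(ℝ, E) I (φ.extend I).symm (φ.extend I p))
      fun v => ?_
    exact DFunLike.congr_fun h4 v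
  · filter_upwards [φ.open_source.mem_nhds hp] with x hx
    exact (φ.extend_left_inv hx).symm

lemma exists_eq_vlift {P : TangentBundle I M} {ξ : TangentSpace I.tangent P}
    (h : dproj P ξ = 0) : ∃ b, ξ = vlift P b := by
  refine ⟨(show E × E from ξ).2, ?_⟩
  rw [dproj_apply] at h
  exact Eq.trans (b := ((0 : E), (show E × E from ξ).2)) (Prod.ext h rfl)
    (vlift_apply P (show E × E from ξ).2).symm

/-- With respect to vertical vectors and `dπ`, the derivative is block triangular with the
derivative of the chart in both diagonal blocks. Injectivity suffices in finite dimension. -/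
lemma isInvertible_coordD_inducedChart (hφ : φ ∈ IsManifold.maximalAtlas I ∞ M)
    {P : TangentBundle I M} (hP : P.proj ∈ φ.source) :
    (coordD I.tangent (inducedChart (I := I) φ) P).IsInvertible := by
  have hd : MDifferentiableAt I.tangent 𝓘(ℝ, E × E) (inducedChart (I := I) φ) P :=
    (contMDiffAt_inducedChart hφ hP).mdifferentiableAt (by simp)
  have hfst : ∀ ξ, (coordD I.tangent (inducedChart (I := I) φ) P ξ).1
      = coordD I (φ.extend I) P.proj (dproj P ξ) := by
    intro ξ
    have h1 := ((hasFDerivAt_fst (𝕜 := ℝ) (E := E) (F := E)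
      (p := inducedChart (I := I) φ P)).hasMFDerivAt).comp P hd.hasMFDerivAt
    have h2 : MDifferentiableAt I 𝓘(ℝ, E) (φ.extend I) P.proj :=
      ((φ.contMDiffOn_extend hφ).contMDiffAt (φ.open_source.mem_nhds hP)).mdifferentiableAt
        (by simp)
    have h3 := h2.hasMFDerivAt.comp P (hasMFDerivAt_proj P).mdifferentiableAt.hasMFDerivAt
    exact DFunLike.congr_fun (hasMFDerivAt_unique h1 h3) ξ
  have hsnd : ∀ b : TangentSpace I P.proj, (coordD I.tangent (inducedChart (I := I) φ) P (vlift P b)).2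
      = coordD I (φ.extend I) P.proj b := by
    intro b
    let L : E →L[ℝ] E := coordD I (φ.extend I) P.proj
    let v : E := P.snd
    have h1 := ((hasFDerivAt_snd (𝕜 := ℝ) (E := E) (F := E)
      (p := inducedChart (I := I) φ P)).hasMFDerivAt).comp P hd.hasMFDerivAt
    have h2 := HasMFDerivAt.comp v h1 (hasMFDerivAt_fiberIncl P)
    have h4 : HasMFDerivAt 𝓘(ℝ, E) 𝓘(ℝ, E) L v L := L.hasFDerivAt.hasMFDerivAt
    rw [vlift_apply]
    exact DFunLike.congr_fun (hasMFDerivAt_unique h2 h4) b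
  have hinj : Function.Injective (coordD I.tangent (inducedChart (I := I) φ) P) := by
    rw [injective_iff_map_eq_zero]
    intro ξ hξ
    have h1 : dproj P ξ = 0 := by
      apply coordD_extend_injective hφ hP
      rw [← hfst, hξ, map_zero]
      rfl
    obtain ⟨b, rfl⟩ := exists_eq_vlift h1
    have h3 : b = 0 := by
      apply coordD_extend_injective hφ hP
      rw [← hsnd, hξ, map_zero]
      rfl
    rw [h3, vlift_apply]
    rfl
  let D : E × E →L[ℝ] E × E := coordD I.tangent (inducedChart (I := I) φ) P
  refine ⟨(LinearEquiv.ofInjectiveEndo (D : E × E →ₗ[ℝ] E × E) hinj).toContinuousLinearEquiv, ?_⟩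
  rfl

/-- The derivative of a map along a curve on which it vanishes. -/
lemma coordD_eq_zero_of_curve {F : Type*} [NormedAddCommGroup F] [NormedSpace ℝ F]
    {f : M → F} {p : M} (hf : MDifferentiableAt I 𝓘(ℝ, F) f p) {ξ : TangentSpace I p} {γ : ℝ → M}
    (hγ : MDifferentiableAt 𝓘(ℝ, ℝ) I γ 0)
    (hv : tangentMap 𝓘(ℝ, ℝ) I γ ⟨0, (1 : ℝ)⟩ = ⟨p, ξ⟩) (h0 : ∀ᶠ t in 𝓝 0, f (γ t) = 0) :
    coordD I f p ξ = 0 := by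
  obtain rfl : γ 0 = p := congrArg TotalSpace.proj hv
  obtain rfl : mfderiv 𝓘(ℝ, ℝ) I γ 0 (1 : ℝ) = ξ := by
    simpa [tangentMap] using hv
  have h1 := hf.hasMFDerivAt.comp (0 : ℝ) hγ.hasMFDerivAt
  have h2 : HasMFDerivAt 𝓘(ℝ, ℝ) 𝓘(ℝ, F) (fun _ : ℝ => (0 : F)) 0 (0 : ℝ →L[ℝ] F) :=
    hasMFDerivAt_const _ _
  have h3 := hasMFDerivAt_unique h1 (h2.congr_of_eventuallyEq h0)
  exact DFunLike.congr_fun h3 (1 : ℝ)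

end InducedChart

/-! ### Derivatives of a vector field at one of its zeros. -/

section Remainder

set_option linter.unusedSectionVars false

variable {E : Type*} [NormedAddCommGroup E] [NormedSpace ℝ E] [FiniteDimensional ℝ E]
  {H : Type*} [TopologicalSpace H] {I : ModelWithCorners ℝ E H} [I.Boundaryless]
  {N : Type*} [TopologicalSpace N] [ChartedSpace H N] [IsManifold I ∞ N]
  (cov : CovariantDerivative I E (TangentSpace I : N → Type _)) {σ : ∀ x : N, TangentSpace I x}
  {p : N}

/-- At a zero of a vector field, the derivative in the direction of a curve along which the field
vanishes is zero. -/
lemma cov_eq_zero_of_curve (hσ : MDiffAt (T% σ) p) (hp : σ p = 0) {ξ : TangentSpace I p}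
    {γ : ℝ → N} (hγ : MDifferentiableAt 𝓘(ℝ, ℝ) I γ 0)
    (hv : tangentMap 𝓘(ℝ, ℝ) I γ ⟨0, (1 : ℝ)⟩ = ⟨p, ξ⟩) (h0 : ∀ᶠ t in 𝓝 0, σ (γ t) = 0) :
    cov σ p ξ = 0 := by
  have hs := mem_chart_source H p
  have hd : MDifferentiableAt I 𝓘(ℝ, E) (fun x => coordD I (extChartAt I p) x (σ x)) p :=
    MDifferentiableAt.coordD_apply
      ((contMDiffAt_extChartAt_infty p hs).of_le (by norm_cast)) hσ
  refine eq_of_coordD_eq hs ?_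
  rw [coordD_cov cov hs hσ, hp, map_zero, map_zero, add_zero]
  refine (coordD_eq_fderiv_comp hs hd ξ).symm.trans (coordD_eq_zero_of_curve hd hγ hv ?_)
  filter_upwards [h0] with t ht
  rw [ht, map_zero]

/-- At a zero of a vector field, all its covariant derivatives agree. -/
lemma cov_eq_flatCov {F : Type*} [NormedAddCommGroup F] [NormedSpace ℝ F] {f : N → F}
    (hf : CMDiffAt 2 f p) (hinv : (coordD I f p).IsInvertible) (hσ : MDiffAt (T% σ) p)
    (hp : σ p = 0) : cov σ p = flatCov f σ p := by
  have h1 : IsCovariantDerivativeOn E (flatCov (I := I) f) {p} :=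
    isCovariantDerivativeOn_flatCov (by rintro _ rfl; exact hf) (by rintro _ rfl; exact hinv)
  have h2 := IsCovariantDerivativeOn.difference_apply cov.isCovariantDerivativeOn h1
    (mem_singleton p) hσ
  -- The difference of two connections is a tensor, evaluated here at the zero vector `σ p`.
  rw [hp, map_zero] at h2
  exact (sub_eq_zero.1 h2.symm)

end Remainder

/-! ### The decomposition of a vector field on the tangent bundle. -/

section Decomposition

set_option linter.unusedSectionVars false

variable {E : Type*} [NormedAddCommGroup E] [NormedSpace ℝ E] [FiniteDimensional ℝ E]
  {H : Type*} [TopologicalSpace H] {I : ModelWithCorners ℝ E H} [I.Boundaryless]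
  {M : Type*} [TopologicalSpace M] [ChartedSpace H M] [IsManifold I ∞ M]
  {g : ContMDiffRiemannianMetric I ∞ E (TangentSpace I : M → Type _)}
  {cov : CovariantDerivative I E (TangentSpace I : M → Type _)}
  {covT : CovariantDerivative I.tangent (E × E)
      (TangentSpace I.tangent : TangentBundle I M → Type _)}
  {Y : ∀ Q : TangentBundle I M, TangentSpace I.tangent Q} {P : TangentBundle I M}
  {A B : ∀ x : M, TangentSpace I x}
  {C D : ∀ Q : TangentBundle I M, TangentSpace I.tangent Q}

/-- The covariant derivative of a vector field on the tangent bundle, in terms of a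
decomposition. -/
theorem cov_eq_of_isDecompositionAt (hcov : IsLeviCivita (fun x v w => g.inner x v w) cov)
    (hY : CMDiffAt ∞ (T% Y) P) (h : IsDecompositionAt cov Y P A B C D)
    {φ : OpenPartialHomeomorph M H} (hφ : φ ∈ IsManifold.maximalAtlas I ∞ M)
    (hP : P.proj ∈ φ.source) (F G : TangentSpace I P.proj) :
    covT Y P (hlift cov P F + vlift P G) = covT (liftField cov A B) P (hlift cov P F + vlift P G)
      + flatDeriv φ (fun Q => C Q + D Q) P (vlift P G) := by
  have hL := contMDiffAt_liftField hcov h.smooth_left h.smooth_right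
  -- `C` and `D` are not assumed smooth; the differentiability of their sum at `P` comes from its
  -- agreement with `Y - (A^h + B^v)` near `P`.
  have hW : MDiffAt (T% (fun Q => Y Q - liftField cov A B Q)) P :=
    (hY.sub_section hL).mdifferentiableAt (by simp)
  have he : (fun Q => Y Q - liftField cov A B Q) =ᶠ[𝓝 P] fun Q => C Q + D Q := by
    filter_upwards [h.eq_add] with Q hQ
    rw [hQ]
    abel
  have hV : MDiffAt (T% (fun Q => C Q + D Q)) P := by
    refine hW.congr_of_eventuallyEq ?_
    filter_upwards [he] with Q hQ
    rw [hQ]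
  have hV0 : C P + D P = 0 := by rw [h.left_eq_zero, h.right_eq_zero, add_zero]
  have h1 : covT Y P = covT (liftField cov A B) P + covT (fun Q => C Q + D Q) P := by
    rw [← covT.congr_of_eventuallyEq hW he]
    rw [← covT.isCovariantDerivativeOn.add (hL.mdifferentiableAt (by simp)) hW (mem_univ P)]
    congr 1
    funext Q
    exact (add_sub_cancel _ _).symm
  have h2 : covT (fun Q => C Q + D Q) P (hlift cov P F) = 0 := by
    obtain ⟨ε, hε, γ, hγ, hv, h0⟩ := h.vanish F
    have hmem : Ioo (-ε) ε ∈ 𝓝 (0 : ℝ) := Ioo_mem_nhds (by linarith) hε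
    refine cov_eq_zero_of_curve covT hV hV0
      ((hγ.smooth.contMDiffAt hmem).mdifferentiableAt (by simp)) hv ?_
    filter_upwards [hmem] with t ht
    rw [(h0 t ht).1, (h0 t ht).2, add_zero]
  have h3 := cov_eq_flatCov covT ((contMDiffAt_inducedChart hφ hP).of_le (by norm_cast))
    (isInvertible_coordD_inducedChart hφ hP) hV hV0
  rw [h1, add_apply, map_add (covT (fun Q => C Q + D Q) P), h2, zero_add, h3]
  rfl

/-- The vector field on the base whose components in the chart at `p` are given by `U`. -/
def coordField (I : ModelWithCorners ℝ E H) (p : M) (U : E → E) (x : M) : TangentSpace I x :=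
  frame I p (U (extChartAt I p x)) x

variable {U : E → E}

lemma coordD_coordField {p x : M} (hx : x ∈ (chartAt H p).source) :
    coordD I (extChartAt I p) x (coordField I p U x) = U (extChartAt I p x) :=
  coordD_frame _ hx

lemma contMDiffAt_coordField {p x : M} (hx : x ∈ (chartAt H p).source)
    (hU : ContDiffAt ℝ ∞ U (extChartAt I p x)) : CMDiffAt ∞ (T% (coordField I p U)) x :=
  contMDiffAt_of_localRep hx (hU.congr_of_eventuallyEq
    (localRep_eventuallyEq hx fun _ => coordD_coordField))

lemma extChartAt_coordField {x : M} (hx : x ∈ (chartAt H P.proj).source) :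
    extChartAt I.tangent P (⟨x, coordField I P.proj U x⟩ : TangentBundle I M)
      = (extChartAt I P.proj x, U (extChartAt I P.proj x)) := by
  rw [extChartAt_tangentBundle hx]
  exact Prod.ext rfl (coordD_coordField hx)

lemma coordField_self (hU : U (extChartAt I P.proj P.proj) = P.snd) :
    (⟨P.proj, coordField I P.proj U P.proj⟩ : TangentBundle I M) = P := by
  have h : coordField I P.proj U P.proj = P.snd := by
    apply eq_of_coordD_eq (mem_chart_source H P.proj)
    rw [coordD_coordField (mem_chart_source H P.proj), hU, coordD_extChartAt_self]
  rw [h]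

/-- The horizontal part of `Y` along the vector field `coordField`. -/
lemma contMDiffAt_dproj_coordField (hY : CMDiffAt ∞ (T% Y) P)
    (hU : ContDiffAt ℝ ∞ U (extChartAt I P.proj P.proj))
    (hu : U (extChartAt I P.proj P.proj) = P.snd) :
    CMDiffAt ∞ (T% (fun x : M => (dproj (⟨x, coordField I P.proj U x⟩ : TangentBundle I M)
      (Y ⟨x, coordField I P.proj U x⟩) : TangentSpace I x))) P.proj ∧
    ContDiffAt ℝ ∞ (fun z => localRep P Y (z, U z)) (extChartAt I P.proj P.proj) := by
  have hp := mem_chart_source H P.proj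
  have h2 : ContDiffAt ℝ ∞ (fun z => localRep P Y (z, U z)) (extChartAt I P.proj P.proj) := by
    have h1 := contDiffAt_localRep (mem_chart_source (ModelProd H E) P) hY
    rw [extChartAt_tangentBundle_self] at h1
    refine ContDiffAt.comp (g := localRep P Y) (f := fun z : E => (z, U z))
      (extChartAt I P.proj P.proj) ?_
      (contDiffAt_id.prodMk hU)
    rw [hu]
    exact h1
  refine ⟨contMDiffAt_of_localRep hp (ContDiffAt.congr_of_eventuallyEq
    (contDiffAt_fst.comp _ h2) (localRep_eventuallyEq hp fun x hx => ?_)), h2⟩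
  have h3 := coordD_tangentBundle_fst (P := P)
    (Q := ⟨x, coordField I P.proj U x⟩) hx (Y ⟨x, coordField I P.proj U x⟩)
  refine h3.symm.trans ?_
  rw [← localRep_apply Y (mem_chartAt_source_tangentBundle.2 hx), extChartAt_coordField hx]
  rfl

lemma contMDiffAt_connectionMap_coordField
    (hcov : IsLeviCivita (fun x v w => g.inner x v w) cov) (hY : CMDiffAt ∞ (T% Y) P)
    (hU : ContDiffAt ℝ ∞ U (extChartAt I P.proj P.proj))
    (hu : U (extChartAt I P.proj P.proj) = P.snd) :
    CMDiffAt ∞ (T% (fun x : M => (connectionMap cov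
      (⟨x, coordField I P.proj U x⟩ : TangentBundle I M)
      (Y ⟨x, coordField I P.proj U x⟩) : TangentSpace I x))) P.proj := by
  have hp := mem_chart_source H P.proj
  have h2 := (contMDiffAt_dproj_coordField hY hU hu).2
  have hΓ := (contDiffOn_christoffel_metricRep P.proj hcov).contDiffAt
    (extChartAt_target_mem_nhds P.proj)
  have h3 : ContDiffAt ℝ ∞ (fun z => (localRep P Y (z, U z)).2
      + christoffel cov P.proj z (localRep P Y (z, U z)).1 (U z)) (extChartAt I P.proj P.proj) :=
    (contDiffAt_snd.comp _ h2).add ((hΓ.clm_apply (contDiffAt_fst.comp _ h2)).clm_apply hU)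
  refine contMDiffAt_of_localRep hp (ContDiffAt.congr_of_eventuallyEq h3
    (localRep_eventuallyEq hp fun x hx => ?_))
  have h4 := coordD_connectionMap cov (P := P)
    (Q := ⟨x, coordField I P.proj U x⟩) hx (Y ⟨x, coordField I P.proj U x⟩)
  refine h4.trans ?_
  rw [← localRep_apply Y (mem_chartAt_source_tangentBundle.2 hx), extChartAt_coordField hx]
  dsimp only
  rw [coordD_coordField hx]

/-- Tangent vectors at base points that are only propositionally equal are compared through their
components in one chart. -/
lemma totalSpace_mk_eq {Q : M} {p : M} {ξ : TangentSpace I Q} {η : TangentSpace I p} (h : Q = p)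
    (h' : coordD I (extChartAt I p) Q ξ = coordD I (extChartAt I p) p η) :
    (⟨Q, ξ⟩ : TangentBundle I M) = ⟨p, η⟩ := by
  subst h
  rw [eq_of_coordD_eq (mem_chart_source H _) h']

/-- The curve over a coordinate line, with values in the vector field `coordField`. -/
def coordCurve (I : ModelWithCorners ℝ E H) (p : M) (U : E → E) (a : E) (t : ℝ) :
    TangentBundle I M :=
  ⟨(extChartAt I p).symm (extChartAt I p p + t • a),
    coordField I p U ((extChartAt I p).symm (extChartAt I p p + t • a))⟩

section Curve

variable {a : E} {t : ℝ}

lemma contMDiffAt_coordCurve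
    (ht : extChartAt I P.proj P.proj + t • a ∈ (extChartAt I P.proj).target)
    (hU : ContDiffAt ℝ ∞ U (extChartAt I P.proj P.proj + t • a)) :
    ContMDiffAt 𝓘(ℝ, ℝ) I.tangent ∞ (coordCurve I P.proj U a) t := by
  have h1 : ContMDiffAt 𝓘(ℝ, ℝ) 𝓘(ℝ, E) ∞ (fun t : ℝ => extChartAt I P.proj P.proj + t • a) t :=
    contMDiffAt_iff_contDiffAt.2 (contDiffAt_const.add (contDiffAt_id.smul contDiffAt_const))
  have h2 : ContMDiffAt 𝓘(ℝ, E) I ∞ (extChartAt I P.proj).symm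
      (extChartAt I P.proj P.proj + t • a) :=
    (contMDiffOn_extChartAt_symm P.proj).contMDiffAt
      ((isOpen_extChartAt_target P.proj).mem_nhds ht)
  have h3 := h2.comp t h1
  refine ContMDiffAt.comp (g := fun x => (⟨x, coordField I P.proj U x⟩ : TangentBundle I M)) t
    (contMDiffAt_coordField (mem_chart_source_of_mem_target ht) ?_) h3
  rwa [(extChartAt I P.proj).right_inv ht]

lemma coordD_mfderiv_coordCurve
    (ht : extChartAt I P.proj P.proj + t • a ∈ (extChartAt I P.proj).target)
    (hU : ContDiffAt ℝ ∞ U (extChartAt I P.proj P.proj + t • a)) :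
    coordD I.tangent (extChartAt I.tangent P) (coordCurve I P.proj U a t)
        (mfderiv 𝓘(ℝ, ℝ) I.tangent (coordCurve I P.proj U a) t (1 : ℝ))
      = (a, fderiv ℝ U (extChartAt I P.proj P.proj + t • a) a) := by
  have hs := mem_chart_source_of_mem_target ht
  have h1 := (contMDiffAt_coordCurve ht hU).mdifferentiableAt (by simp)
  have h2 : MDifferentiableAt I.tangent 𝓘(ℝ, E × E) (extChartAt I.tangent P)
      (coordCurve I P.proj U a t) :=
    (contMDiffAt_extChartAt_infty P
      (mem_chartAt_source_tangentBundle.2 hs)).mdifferentiableAt (by simp)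
  have h3 := h2.hasMFDerivAt.comp t h1.hasMFDerivAt
  have h4 : HasFDerivAt (fun t : ℝ => extChartAt I P.proj P.proj + t • a)
      (ContinuousLinearMap.toSpanSingleton ℝ a) t := by
    have := ((hasDerivAt_id t).smul_const a).const_add (extChartAt I P.proj P.proj)
    rw [one_smul] at this
    exact this.hasFDerivAt
  have h5 := h4.prodMk ((hU.differentiableAt (by simp)).hasFDerivAt.comp t h4)
  have h6 := hasMFDerivAt_unique (h3.congr_of_eventuallyEq ?_) h5.hasMFDerivAt
  · have h7 := DFunLike.congr_fun h6 (1 : ℝ)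
    refine h7.trans ?_
    change (((1 : ℝ) • a, fderiv ℝ U (extChartAt I P.proj P.proj + t • a) ((1 : ℝ) • a)) : E × E) = _
    rw [one_smul]
  · have hc : ContinuousAt (fun t : ℝ => extChartAt I P.proj P.proj + t • a) t := h4.continuousAt
    filter_upwards [hc.preimage_mem_nhds ((isOpen_extChartAt_target P.proj).mem_nhds ht)] with x hx
    refine Eq.symm ((extChartAt_coordField (mem_chart_source_of_mem_target hx)).trans ?_)
    rw [(extChartAt I P.proj).right_inv hx]
    rfl

/-- In coordinates the velocity is `(a, dU(a))`, and `K` of it has the components `dU(a) + Γ(a, U)`: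
horizontality is the equation of parallel transport. -/
lemma connectionMap_mfderiv_coordCurve
    (ht : extChartAt I P.proj P.proj + t • a ∈ (extChartAt I P.proj).target)
    (hU : ContDiffAt ℝ ∞ U (extChartAt I P.proj P.proj + t • a))
    (hpar : fderiv ℝ U (extChartAt I P.proj P.proj + t • a) a
      = -christoffel cov P.proj (extChartAt I P.proj P.proj + t • a) a
        (U (extChartAt I P.proj P.proj + t • a))) :
    connectionMap cov (coordCurve I P.proj U a t)
      (mfderiv 𝓘(ℝ, ℝ) I.tangent (coordCurve I P.proj U a) t (1 : ℝ)) = 0 := by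
  have hs := mem_chart_source_of_mem_target ht
  refine eq_of_coordD_eq hs (Eq.trans ?_ (map_zero (coordD I (extChartAt I P.proj) _)).symm)
  refine (coordD_connectionMap cov (P := P) (Q := coordCurve I P.proj U a t) hs _).trans ?_
  rw [coordD_mfderiv_coordCurve ht hU, hpar]
  have h1 : coordD I (extChartAt I P.proj) (coordCurve I P.proj U a t).proj
      (coordCurve I P.proj U a t).snd = U (extChartAt I P.proj P.proj + t • a) := by
    refine (coordD_coordField hs).trans ?_
    rw [(extChartAt I P.proj).right_inv ht]
  have h2 : extChartAt I P.proj (coordCurve I P.proj U a t).proj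
      = extChartAt I P.proj P.proj + t • a := (extChartAt I P.proj).right_inv ht
  rw [h1, h2]
  exact neg_add_cancel _

/-- At the center, which lies on all rays, parallelism holds in every direction, so the velocity
`(a, -Γ(a, u))` is the horizontal lift. -/
lemma tangentMap_coordCurve
    (hU : ContDiffAt ℝ ∞ U (extChartAt I P.proj P.proj))
    (hu : U (extChartAt I P.proj P.proj) = P.snd) (b : TangentSpace I P.proj)
    (hpar : ∀ a, fderiv ℝ U (extChartAt I P.proj P.proj) a
      = -christoffel cov P.proj (extChartAt I P.proj P.proj) a
        (U (extChartAt I P.proj P.proj))) :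
    tangentMap 𝓘(ℝ, ℝ) I.tangent (coordCurve I P.proj U (coordD I (extChartAt I P.proj) P.proj b))
      ⟨0, (1 : ℝ)⟩ = ⟨P, hlift cov P b⟩ := by
  set a := coordD I (extChartAt I P.proj) P.proj b
  have h0 : extChartAt I P.proj P.proj + (0 : ℝ) • a = extChartAt I P.proj P.proj := by
    rw [zero_smul, add_zero]
  refine totalSpace_mk_eq ?_ ?_
  · have h1 : coordCurve I P.proj U a 0
        = ⟨P.proj, coordField I P.proj U P.proj⟩ := by
      rw [coordCurve, h0, extChartAt_symm_apply (mem_chart_source H P.proj)]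
    exact h1.trans (coordField_self hu)
  · refine (coordD_mfderiv_coordCurve (by rw [h0]; exact mem_extChartAt_target P.proj)
      (by rwa [h0])).trans ?_
    rw [h0, coordD_hlift cov (mem_chart_source H P.proj), hpar, hu,
      coordD_extChartAt_self P.proj P.snd]

end Curve

/-- Every smooth vector field on the tangent bundle has a decomposition at every point. -/
theorem exists_isDecompositionAt (hcov : IsLeviCivita (fun x v w => g.inner x v w) cov)
    (hY : CMDiffAt ∞ (T% Y) P) :
    ∃ (A B : ∀ x : M, TangentSpace I x) (C D : ∀ Q : TangentBundle I M, TangentSpace I.tangent Q),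
      IsDecompositionAt cov Y P A B C D := by
  have : CompleteSpace E := FiniteDimensional.complete ℝ E
  obtain ⟨r, hr, hball, U, hU, hu, hpar⟩ := exists_radially_parallel_of_contDiffOn
    (W := E →L[ℝ] E) (ContinuousLinearMap.id ℝ (E →L[ℝ] E)) (isOpen_extChartAt_target P.proj)
    (contDiffOn_christoffel_metricRep P.proj hcov) (mem_extChartAt_target P.proj) (P.snd : E)
  have hUa : ∀ z ∈ Metric.ball (extChartAt I P.proj P.proj) r, ContDiffAt ℝ ∞ U z := fun z hz =>
    hU.contDiffAt (Metric.isOpen_ball.mem_nhds hz)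
  have hU0 := hUa _ (Metric.mem_ball_self hr)
  -- The radially parallel section through `P`; on its image `C` and `D` vanish by construction.
  let s : M → TangentBundle I M := fun x => ⟨x, coordField I P.proj U x⟩
  have hs : s P.proj = P := coordField_self hu
  let A : ∀ x : M, TangentSpace I x := fun x => dproj (s x) (Y (s x))
  let B : ∀ x : M, TangentSpace I x := fun x => connectionMap cov (s x) (Y (s x))
  let C : ∀ Q : TangentBundle I M, TangentSpace I.tangent Q :=
    fun Q => hlift cov Q (dproj Q (Y Q) - A Q.proj)
  let D : ∀ Q : TangentBundle I M, TangentSpace I.tangent Q :=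
    fun Q => vlift Q (connectionMap cov Q (Y Q) - B Q.proj)
  have hC : ∀ x, C (s x) = 0 := by
    intro x
    have h1 : dproj (s x) (Y (s x)) - A (s x).proj = 0 := sub_self _
    refine eq_of_dproj_of_connectionMap cov ?_ ?_
    · rw [dproj_hlift, h1, map_zero]
    · rw [connectionMap_hlift, connectionMap_zero]
  have hD : ∀ x, D (s x) = 0 := by
    intro x
    have h1 : connectionMap cov (s x) (Y (s x)) - B (s x).proj = 0 := sub_self _
    refine eq_of_dproj_of_connectionMap cov ?_ ?_
    · rw [dproj_vlift, map_zero]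
    · rw [connectionMap_vlift, h1, connectionMap_zero]
  refine ⟨A, B, C, D, (contMDiffAt_dproj_coordField hY hU0 hu).1,
    contMDiffAt_connectionMap_coordField hcov hY hU0 hu, Eventually.of_forall fun Q => ?_,
    Eventually.of_forall fun Q => connectionMap_hlift cov Q _,
    Eventually.of_forall fun Q => dproj_vlift Q _, hs ▸ hC P.proj, hs ▸ hD P.proj, fun b => ?_⟩
  · refine eq_of_dproj_of_connectionMap cov ?_ ?_
    · simp only [liftField, map_add, dproj_hlift, dproj_vlift, C, D]
      abel
    · simp only [liftField, connectionMap_add, connectionMap_hlift, connectionMap_vlift, C, D]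
      abel
  · set a := coordD I (extChartAt I P.proj) P.proj b with ha
    -- The denominator `‖a‖ + 1` keeps the ray inside the ball and also covers `a = 0`.
    have hε : ∀ t ∈ Ioo (-(r / (‖a‖ + 1))) (r / (‖a‖ + 1)), ‖t • a‖ < r := by
      intro t ht
      have h1 : |t| < r / (‖a‖ + 1) := abs_lt.2 ht
      have h2 : 0 < ‖a‖ + 1 := by positivity
      rw [lt_div_iff₀ h2] at h1
      rw [norm_smul, Real.norm_eq_abs]
      nlinarith [abs_nonneg t]
    have hb : ∀ t ∈ Ioo (-(r / (‖a‖ + 1))) (r / (‖a‖ + 1)),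
        extChartAt I P.proj P.proj + t • a ∈ Metric.ball (extChartAt I P.proj P.proj) r := by
      intro t ht
      rw [mem_ball_iff_norm, add_sub_cancel_left]
      exact hε t ht
    refine ⟨r / (‖a‖ + 1), by positivity, coordCurve I P.proj U a, ⟨?_, ?_⟩, ?_, ?_⟩
    · exact fun t ht => (contMDiffAt_coordCurve (hball (hb t ht))
        (hUa _ (hb t ht))).contMDiffWithinAt
    · exact fun t ht => connectionMap_mfderiv_coordCurve (hball (hb t ht)) (hUa _ (hb t ht))
        (hpar a t (hε t ht))
    · refine tangentMap_coordCurve hU0 hu b fun a => ?_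
      have h1 := hpar a 0 (by rw [zero_smul, norm_zero]; exact hr)
      rw [zero_smul, add_zero] at h1
      exact h1
    -- The curve lies in the image of `s`.
    · exact fun t _ => ⟨hC _, hD _⟩

end Decomposition

end

theorem mainTheorem4 {E : Type*} [NormedAddCommGroup E] [NormedSpace ℝ E] [FiniteDimensional ℝ E]
    {M : Type*} [TopologicalSpace M] [T2Space M] [ChartedSpace E M] [IsManifold 𝓘(ℝ, E) ∞ M]
    (g : ContMDiffRiemannianMetric 𝓘(ℝ, E) ∞ E (TangentSpace 𝓘(ℝ, E) : M → Type _))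
    (cov : CovariantDerivative 𝓘(ℝ, E) E (TangentSpace 𝓘(ℝ, E) : M → Type _))
    (hcov : IsLeviCivita (fun x v w => g.inner x v w) cov)
    (m₁ m₂ m₃ : ℝ) (hm₁ : 0 < m₁) (hm₃ : 0 < m₃) (hm : 0 < m₁ * m₃ - m₂ ^ 2)
    (covT : CovariantDerivative 𝓘(ℝ, E).tangent (E × E)
      (TangentSpace 𝓘(ℝ, E).tangent : TangentBundle 𝓘(ℝ, E) M → Type _))
    (hcovT : IsLeviCivita (liftMetric (fun x v w => g.inner x v w) cov m₁ m₂ m₃) covT)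
    (X Y : ∀ Q : TangentBundle 𝓘(ℝ, E) M, TangentSpace 𝓘(ℝ, E).tangent Q)
    (hX : CMDiff ∞ (T% X)) (hY : CMDiff ∞ (T% Y)) (P : TangentBundle 𝓘(ℝ, E) M) :
    (∃ (A B : ∀ x : M, TangentSpace 𝓘(ℝ, E) x)
      (C D : ∀ Q : TangentBundle 𝓘(ℝ, E) M, TangentSpace 𝓘(ℝ, E).tangent Q),
      IsDecompositionAt cov Y P A B C D) ∧
    ∀ (A B : ∀ x : M, TangentSpace 𝓘(ℝ, E) x)
      (C D : ∀ Q : TangentBundle 𝓘(ℝ, E) M, TangentSpace 𝓘(ℝ, E).tangent Q),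
      IsDecompositionAt cov Y P A B C D →
      ∀ F G : TangentSpace 𝓘(ℝ, E) P.proj, X P = hlift cov P F + vlift P G →
        (∀ φ ∈ IsManifold.maximalAtlas 𝓘(ℝ, E) ∞ M, P.proj ∈ φ.source →
          covT Y P (X P) = covT (liftField cov A B) P (hlift cov P F + vlift P G)
            + flatDeriv φ (fun Q => C Q + D Q) P (vlift P G)) ∧
        dproj P (covT (liftField cov A B) P (hlift cov P F + vlift P G))
          = cov A P.proj F + (m₁ * m₃ - m₂ ^ 2)⁻¹ •
            ((m₂ * m₃) • curvature cov P.proj P.snd F (A P.proj)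
              + (m₂ * m₃ / 2) • curvature cov P.proj F (A P.proj) P.snd
              + (m₃ ^ 2 / 2) • curvature cov P.proj P.snd (B P.proj) F
              + (m₃ ^ 2 / 2) • curvature cov P.proj P.snd G (A P.proj)) ∧
        connectionMap cov P (covT (liftField cov A B) P (hlift cov P F + vlift P G))
          = cov B P.proj F + (m₁ * m₃ - m₂ ^ 2)⁻¹ •
            (-(m₂ ^ 2) • curvature cov P.proj P.snd F (A P.proj)
              - (m₁ * m₃ / 2) • curvature cov P.proj F (A P.proj) P.snd
              - (m₂ * m₃ / 2) • curvature cov P.proj P.snd (B P.proj) F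
              - (m₂ * m₃ / 2) • curvature cov P.proj P.snd G (A P.proj)) := by
  refine ⟨exists_isDecompositionAt hcov hY.contMDiffAt, fun A B C D h F G hFG => ⟨?_, ?_⟩⟩
  · intro φ hφ hP
    rw [hFG]
    exact cov_eq_of_isDecompositionAt hcov hY.contMDiffAt h hφ hP F G
  · exact cov_liftField hcov hcovT hm.ne' h.smooth_left h.smooth_right F G
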